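/- Let $\Bbbk$ be a field of characteristic $0$ and let $q\in\Bbbk$, $q\ne0$, not be a root of unity. Let $A=\mathcal O_q(SL(2))$ be the $\Bbbk$-algebra generated by $\alpha,\beta,\gamma,\delta$ with relations $\alpha\beta=q\beta\alpha$, $\alpha\gamma=q\gamma\alpha$, $\beta\gamma=\gamma\beta$, $\beta\delta=q\delta\beta$, $\gamma\delta=q\delta\gamma$, $\alpha\delta=\delta\alpha+(q-q^{-1})\beta\gamma$, $\alpha\delta-q\beta\gamma=1$, graded by $|\alpha|=|\gamma|=1$, $|\beta|=|\delta|=-1$ (equivalently, with the corresponding coaction of $H=\Bbbk[z,z^{-1}]$), and let $B=\mathcal O_q(S^2)=A^{coH}$ be its subalgebra of degree $0$. Let $\Omega(A)$ be the differential graded algebra of the 3D calculus: it is generated by $A$ and one-forms $\omega_0,\omega_\pm$ with relations $\omega_0a=q^{-2|a|}a\omega_0$, $\omega_\pm a=q^{-|a|}a\omega_\pm$ for homogeneous $a\in A$, $\omega_i^2=0$, $\omega_+\omega_-=-q^2\omega_-\omega_+$, $\omega_0\omega_-=-q^4\omega_-\omega_0$, $\omega_+\omega_0=-q^4\omega_0\omega_+$,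 and its differential is given by $d\alpha=\alpha\omega_0-q\beta\omega_+$, $d\beta=-q^2\beta\omega_0+\alpha\omega_-$, $d\gamma=\gamma\omega_0-q\delta\omega_+$, $d\delta=-q^2\delta\omega_0+\gamma\omega_-$, $d\omega_0=q\omega_-\omega_+$, $d\omega_+=q^2(q^2+1)\omega_0\omega_+$, $d\omega_-=q^2(q^2+1)\omega_-\omega_0$. Write $da=\sum_i\partial_i(a)\omega_i$ for $a\in A$. Let $\Omega(B)\subseteq\Omega(A)$ be the induced calculus, $\Omega^n(B)=\operatorname{span}\{b_0\,db_1\cdots db_n: b_i\in B\}$. For an algebra $R$ with a differential graded algebra $\Omega(R)$ over it, write $\Omega^n(R)^*=\operatorname{Hom}_R(\Omega^n(R),R)$ for the right $R$-linear maps, an $R$-bimodule by $(afb)(\omega)=a f(b\omega)$, and put $(f\omega)(\omega')=f(\omega\omega')$. A hom-connection on $R$ is a linear map $\nabla:\Omega^1(R)^*\to R$ with $\nabla(fa)=\nabla(f)a+f(da)$; it extends to $\nabla_n:\Omega^{n+1}(R)^*\to\Omega^n(R)^*$ by $\nabla_n(f)(\omega)=\nabla(f\omega)+(-1)^{n+1}f(d\omega)$,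 and it is flat if $\nabla\circ\nabla_1=0$; its integral complex is then the complex of all $\Omega^n(R)^*$ with the maps $\nabla_n$ and $\nabla$. On $A$ take the hom-connection $\nabla(f)=\partial_0(f(\omega_0))+q^{-2}\partial_+(f(\omega_+))+q^2\partial_-(f(\omega_-))$. Let $j:\Omega^1(B)\otimes_BA\to\Omega^1(A)$, $\omega\otimes a\mapsto\omega a$, and for $f\in\Omega^1(B)^*$ let $\widehat f:\Omega^1(B)\otimes_BA\to A$, $\omega\otimes a\mapsto f(\omega)a$. Then the following hold. 1. There is a linear map $\Pi:\Omega^1(A)\to\Omega^1(B)\otimes_BA$ with $\Pi\circ j=\mathrm{id}$ and $j(\Pi(\omega_-a+\omega_0b+\omega_+c))=\omega_-a+\omega_+c$ for all $a,b,c\in A$; each $\widehat f\circ\Pi$ is right $A$-linear, $\nabla$ maps it into $B$, and $\nabla^{coH}(f):=\nabla(\widehat f\circ\Pi)$ defines a hom-connection $\nabla^{coH}$ on $B$ with respect to $\Omega(B)$. 2. Put $(b_1,b_2,b_3)=(\alpha^2,\gamma^2,\alpha\gamma)$, $(a_1,a_2,a_3)=(\delta^2,q^2\beta^2,-(q+q^{-1})\beta\delta)$,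 $(q_1,q_2,q_3)=(1,q^{-4},q^{-2})$. The elements $w_i=\omega_+a_i$ and $u_i=\omega_-b_i$ lie in $\Omega^1(B)$, and $\Omega^1(B)=\Gamma_+\oplus\Gamma_-$ where $\Gamma_+$, $\Gamma_-$ are the sub-bimodules generated by the $w_i$ and by the $u_i$. There are $w_i^*,u_i^*\in\Omega^1(B)^*$ with $w_i^*(w_j)=q_ib_ia_j$, $w_i^*(u_j)=0$, $u_i^*(u_j)=a_ib_j$, $u_i^*(w_j)=0$. 3. The maps $\Psi:\Omega^1(B)\to\Omega^1(B)^*$, $\Psi(\omega)=\sum_iu_i^*\,w_i^*(\omega)-q^2\sum_iq_i^{-1}w_i^*\,u_i^*(\omega)$; $\Theta:B\to\Omega^2(B)$, $\Theta(b)=\omega_-\omega_+b$; and $\Theta^*:B\to\Omega^2(B)^*$, $\Theta^*(b)=\phi b$, where $\phi\in\Omega^2(B)^*$ satisfies $\phi(\omega_-\omega_+b)=b$, are well defined isomorphisms of $B$-bimodules. 4. The diagram they form commutes: $\nabla^{coH}_1\circ\Theta^*=\Psi\circ d$ on $B$, and $d=\Theta\circ\nabla^{coH}\circ\Psi$ on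 $\Omega^1(B)$. 5. $\nabla^{coH}$ is flat, $\Omega^n(B)=0$ for $n>2$, and the integral complex of $\nabla^{coH}$ is isomorphic to the de Rham complex $(\Omega(B),d)$, with $\Omega^n(B)\cong\Omega^{2-n}(B)^*$ for $n=0,1,2$. -/

import Mathlib

open scoped LaurentPolynomial TensorProduct

set_option linter.unusedSimpArgs false
set_option linter.unnecessarySeqFocus false

noncomputable section

namespace QSphere

universe u v w

/-- The generators `α, β, γ, δ` of `O_q(SL(2))`. -/
inductive Gen
  | al | be | ga | de

/-- Labels of the left-invariant one-forms `ω_0, ω_+, ω_-`. -/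
inductive OneForm
  | zero | plus | minus

open Gen OneForm

/-- The `ℤ`-degree of the generators. -/
def Gen.deg : Gen → ℤ
  | al => 1
  | be => -1
  | ga => 1
  | de => -1

/-- The exponents in `ω_i a = q^(-wt i * |a|) a ω_i`. -/
def OneForm.wt : OneForm → ℤ
  | zero => 2
  | plus => 1
  | minus => 1

variable {k : Type u} [Field k]

/-- The defining relations of `O_q(SL(2))` for a family `x` of four elements of an algebra. -/
inductive SLRel (q : kˣ) {R : Type v} [Ring R] [Algebra k R] (x : Gen → R) : R → R → Prop
  | ab : SLRel q x (x al * x be) ((q : k) • (x be * x al))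
  | ag : SLRel q x (x al * x ga) ((q : k) • (x ga * x al))
  | bg : SLRel q x (x be * x ga) (x ga * x be)
  | bd : SLRel q x (x be * x de) ((q : k) • (x de * x be))
  | gd : SLRel q x (x ga * x de) ((q : k) • (x de * x ga))
  | ad : SLRel q x (x al * x de) (x de * x al + ((q : k) - (q : k)⁻¹) • (x be * x ga))
  | det : SLRel q x (x al * x de - (q : k) • (x be * x ga)) 1

/-- The elements `x` satisfy the relations of `O_q(SL(2))`. -/
structure SLHolds (q : kˣ) {R : Type v} [Ring R] [Algebra k R] (x : Gen → R) : Prop where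
  ab : x al * x be = (q : k) • (x be * x al)
  ag : x al * x ga = (q : k) • (x ga * x al)
  bg : x be * x ga = x ga * x be
  bd : x be * x de = (q : k) • (x de * x be)
  gd : x ga * x de = (q : k) • (x de * x ga)
  ad : x al * x de = x de * x al + ((q : k) - (q : k)⁻¹) • (x be * x ga)
  det : x al * x de - (q : k) • (x be * x ga) = 1

theorem SLHolds.map {q : kˣ} {R : Type v} [Ring R] [Algebra k R] {S : Type w} [Ring S]
    [Algebra k S] {x : Gen → R} (h : SLHolds q x) (f : R →ₐ[k] S) :
    SLHolds q (fun g => f (x g)) where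
  ab := by simpa using congrArg f h.ab
  ag := by simpa using congrArg f h.ag
  bg := by simpa using congrArg f h.bg
  bd := by simpa using congrArg f h.bd
  gd := by simpa using congrArg f h.gd
  ad := by simpa using congrArg f h.ad
  det := by simpa using congrArg f h.det

/-- The algebra `O_q(SL(2))`, by generators and relations. -/
def OqSL2 (q : kˣ) : Type u := RingQuot (SLRel q (FreeAlgebra.ι k (X := Gen)))

instance (q : kˣ) : Ring (OqSL2 q) :=
  inferInstanceAs (Ring (RingQuot (SLRel q (FreeAlgebra.ι k (X := Gen)))))

instance (q : kˣ) : Algebra k (OqSL2 q) :=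
  inferInstanceAs (Algebra k (RingQuot (SLRel q (FreeAlgebra.ι k (X := Gen)))))

namespace OqSL2

def mk (q : kˣ) : FreeAlgebra k Gen →ₐ[k] OqSL2 q :=
  RingQuot.mkAlgHom k (SLRel q (FreeAlgebra.ι k (X := Gen)))

def gen (q : kˣ) (g : Gen) : OqSL2 q := mk q (FreeAlgebra.ι k g)

theorem holds (q : kˣ) : SLHolds q (gen q) := by
  have h : ∀ {a b}, SLRel q (FreeAlgebra.ι k (X := Gen)) a b → mk q a = mk q b :=
    fun h => RingQuot.mkAlgHom_rel k h
  constructor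
  · simpa [gen] using h SLRel.ab
  · simpa [gen] using h SLRel.ag
  · simpa [gen] using h SLRel.bg
  · simpa [gen] using h SLRel.bd
  · simpa [gen] using h SLRel.gd
  · simpa [gen] using h SLRel.ad
  · simpa [gen] using h SLRel.det

/-- The universal property of `O_q(SL(2))`. -/
def lift (q : kˣ) {R : Type v} [Ring R] [Algebra k R] (x : Gen → R) (h : SLHolds q x) :
    OqSL2 q →ₐ[k] R :=
  RingQuot.liftAlgHom k ⟨FreeAlgebra.lift k x, by
    intro a b r
    cases r
    · simpa using h.ab
    · simpa using h.ag
    · simpa using h.bg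
    · simpa using h.bd
    · simpa using h.gd
    · simpa using h.ad
    · simpa using h.det⟩

@[simp] theorem lift_gen (q : kˣ) {R : Type v} [Ring R] [Algebra k R] (x : Gen → R)
    (h : SLHolds q x) (g : Gen) : lift q x h (gen q g) = x g := by
  unfold lift gen mk
  erw [RingQuot.liftAlgHom_mkAlgHom_apply]
  simp

theorem adjoin_gen (q : kˣ) : Algebra.adjoin k (Set.range (gen q)) = ⊤ := by
  have h1 : (mk q).range = ⊤ :=
    (AlgHom.range_eq_top _).2 (RingQuot.mkAlgHom_surjective k _)
  have h2 : Set.range (gen q) = mk q '' Set.range (FreeAlgebra.ι k) := by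
    rw [← Set.range_comp]; rfl
  rw [h2, ← AlgHom.map_adjoin, FreeAlgebra.adjoin_range_ι, Algebra.map_top, h1]

/-- The automorphism that multiplies the part of degree `n` by `c^n`. -/
def scale (q : kˣ) (c : kˣ) : OqSL2 q →ₐ[k] OqSL2 q :=
  lift q (fun g => ((c ^ g.deg : kˣ) : k) • gen q g) (by
    have h := holds q
    constructor
    all_goals simp only [Gen.deg, zpow_one, zpow_neg, smul_mul_smul_comm, Units.mul_inv,
      Units.inv_mul, one_smul]
    · rw [h.ab]
    · rw [h.ag, smul_comm]
    · rw [h.bg]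
    · rw [h.bd, smul_comm]
    · rw [h.gd]
    · exact h.ad
    · exact h.det)

/-- The coaction of `k[z, z⁻¹]` that encodes the `ℤ`-grading: `a ↦ a z^|a|` on generators, with
`A ⊗ k[z, z⁻¹] = A[z, z⁻¹]`. -/
def coaction (q : kˣ) : OqSL2 q →ₐ[k] (OqSL2 q)[T;T⁻¹] :=
  lift q (fun g => AddMonoidAlgebra.single g.deg (gen q g)) (by
    have h := holds q
    constructor
    all_goals simp only [Gen.deg, AddMonoidAlgebra.single_mul_single,
      AddMonoidAlgebra.smul_single, ← AddMonoidAlgebra.single_add]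
    · rw [h.ab]; rfl
    · rw [h.ag]
    · rw [h.bg]; rfl
    · rw [h.bd]
    · rw [h.gd]; rfl
    · rw [h.ad, AddMonoidAlgebra.single_add]
      norm_num
    · norm_num only
      rw [← AddMonoidAlgebra.single_sub, h.det]; rfl)

end OqSL2

/-- The standard Podleś sphere `O_q(S²)`: the coinvariants (the part of degree zero) of `O_q(SL(2))`. -/
def podles (q : kˣ) : Subalgebra k (OqSL2 q) :=
  AlgHom.equalizer (OqSL2.coaction q) AddMonoidAlgebra.singleZeroAlgHom

/-- The defining relations of the differential forms of the 3D calculus on `O_q(SL(2))`: those of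
`O_q(SL(2))`, the commutation rules of one-forms with functions, and those among one-forms. -/
inductive OmegaRel (q : kˣ) : FreeAlgebra k (Gen ⊕ OneForm) → FreeAlgebra k (Gen ⊕ OneForm) → Prop
  | base {a b : FreeAlgebra k (Gen ⊕ OneForm)}
      (h : SLRel q (fun g => FreeAlgebra.ι k (Sum.inl g)) a b) : OmegaRel q a b
  | comm (i : OneForm) (g : Gen) : OmegaRel q
      (FreeAlgebra.ι k (Sum.inr i) * FreeAlgebra.ι k (Sum.inl g))
      (((q ^ (-(i.wt * g.deg)) : kˣ) : k) •
        (FreeAlgebra.ι k (Sum.inl g) * FreeAlgebra.ι k (Sum.inr i)))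
  | sq (i : OneForm) : OmegaRel q (FreeAlgebra.ι k (Sum.inr i) * FreeAlgebra.ι k (Sum.inr i)) 0
  | pm : OmegaRel q (FreeAlgebra.ι k (Sum.inr plus) * FreeAlgebra.ι k (Sum.inr minus))
      ((-(q : k) ^ 2) • (FreeAlgebra.ι k (Sum.inr minus) * FreeAlgebra.ι k (Sum.inr plus)))
  | zm : OmegaRel q (FreeAlgebra.ι k (Sum.inr zero) * FreeAlgebra.ι k (Sum.inr minus))
      ((-(q : k) ^ 4) • (FreeAlgebra.ι k (Sum.inr minus) * FreeAlgebra.ι k (Sum.inr zero)))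
  | pz : OmegaRel q (FreeAlgebra.ι k (Sum.inr plus) * FreeAlgebra.ι k (Sum.inr zero))
      ((-(q : k) ^ 4) • (FreeAlgebra.ι k (Sum.inr zero) * FreeAlgebra.ι k (Sum.inr plus)))

/-- The elements `x`, `w` satisfy the relations of the 3D calculus. -/
structure OmegaHolds (q : kˣ) {R : Type v} [Ring R] [Algebra k R] (x : Gen → R)
    (w : OneForm → R) : Prop where
  base : SLHolds q x
  comm : ∀ i g, w i * x g = ((q ^ (-(i.wt * g.deg)) : kˣ) : k) • (x g * w i)
  sq : ∀ i, w i * w i = 0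
  pm : w plus * w minus = (-(q : k) ^ 2) • (w minus * w plus)
  zm : w zero * w minus = (-(q : k) ^ 4) • (w minus * w zero)
  pz : w plus * w zero = (-(q : k) ^ 4) • (w zero * w plus)

/-- The algebra `Ω(A)` of differential forms of the 3D calculus on `A = O_q(SL(2))`. -/
def Omega (q : kˣ) : Type u := RingQuot (OmegaRel q)

instance (q : kˣ) : Ring (Omega q) := inferInstanceAs (Ring (RingQuot (OmegaRel q)))

instance (q : kˣ) : Algebra k (Omega q) := inferInstanceAs (Algebra k (RingQuot (OmegaRel q)))

namespace Omega

def mk (q : kˣ) : FreeAlgebra k (Gen ⊕ OneForm) →ₐ[k] Omega q :=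
  RingQuot.mkAlgHom k (OmegaRel q)

def gen (q : kˣ) (g : Gen) : Omega q := mk q (FreeAlgebra.ι k (Sum.inl g))

def form (q : kˣ) (i : OneForm) : Omega q := mk q (FreeAlgebra.ι k (Sum.inr i))

theorem holds (q : kˣ) : OmegaHolds q (gen q) (form q) := by
  have h : ∀ {a b}, OmegaRel q a b → mk q a = mk q b := fun h => RingQuot.mkAlgHom_rel k h
  refine ⟨⟨?_, ?_, ?_, ?_, ?_, ?_, ?_⟩, fun i g => ?_, fun i => ?_, ?_, ?_, ?_⟩
  · simpa [gen] using h (.base .ab)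
  · simpa [gen] using h (.base .ag)
  · simpa [gen] using h (.base .bg)
  · simpa [gen] using h (.base .bd)
  · simpa [gen] using h (.base .gd)
  · simpa [gen] using h (.base .ad)
  · simpa [gen] using h (.base .det)
  · simpa [gen, form] using h (.comm i g)
  · simpa [form] using h (.sq i)
  · simpa [form] using h .pm
  · simpa [form] using h .zm
  · simpa [form] using h .pz

/-- The universal property of `Ω(A)`. -/
def lift (q : kˣ) {R : Type v} [Ring R] [Algebra k R] (x : Gen → R) (w : OneForm → R)
    (h : OmegaHolds q x w) : Omega q →ₐ[k] R :=
  RingQuot.liftAlgHom k ⟨FreeAlgebra.lift k (Sum.elim x w), by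
    intro a b r
    rcases r with ⟨r⟩ | ⟨i, g⟩ | ⟨i⟩ | _ | _ | _
    · cases r
      · simpa using h.base.ab
      · simpa using h.base.ag
      · simpa using h.base.bg
      · simpa using h.base.bd
      · simpa using h.base.gd
      · simpa using h.base.ad
      · simpa using h.base.det
    · simpa using h.comm i g
    · simpa using h.sq i
    · simpa using h.pm
    · simpa using h.zm
    · simpa using h.pz⟩

@[simp] theorem lift_gen (q : kˣ) {R : Type v} [Ring R] [Algebra k R] (x : Gen → R)
    (w : OneForm → R) (h : OmegaHolds q x w) (g : Gen) : lift q x w h (gen q g) = x g := by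
  unfold lift gen mk
  erw [RingQuot.liftAlgHom_mkAlgHom_apply]
  simp

@[simp] theorem lift_form (q : kˣ) {R : Type v} [Ring R] [Algebra k R] (x : Gen → R)
    (w : OneForm → R) (h : OmegaHolds q x w) (i : OneForm) : lift q x w h (form q i) = w i := by
  unfold lift form mk
  erw [RingQuot.liftAlgHom_mkAlgHom_apply]
  simp

theorem induction (q : kˣ) {P : Omega q → Prop} (hs : ∀ c : k, P (algebraMap k _ c))
    (hg : ∀ g, P (gen q g)) (hf : ∀ i, P (form q i))
    (ha : ∀ x y, P x → P y → P (x + y)) (hm : ∀ x y, P x → P y → P (x * y)) (x : Omega q) :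
    P x := by
  obtain ⟨y, rfl⟩ := RingQuot.mkAlgHom_surjective k (OmegaRel q) x
  change P (mk q y)
  induction y using FreeAlgebra.induction with
  | grade0 c => rw [AlgHom.commutes]; exact hs c
  | grade1 i =>
    rcases i with g | i
    · exact hg g
    · exact hf i
  | mul a b h1 h2 => rw [map_mul]; exact hm _ _ h1 h2
  | add a b h1 h2 => rw [map_add]; exact ha _ _ h1 h2

/-- The differentials of the generators. -/
def dGen (q : kˣ) : Gen → Omega q
  | al => gen q al * form q zero - (q : k) • (gen q be * form q plus)
  | be => (-(q : k) ^ 2) • (gen q be * form q zero) + gen q al * form q minus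
  | ga => gen q ga * form q zero - (q : k) • (gen q de * form q plus)
  | de => (-(q : k) ^ 2) • (gen q de * form q zero) + gen q ga * form q minus

/-- The differentials of the left-invariant one-forms. -/
def dForm (q : kˣ) : OneForm → Omega q
  | zero => (q : k) • (form q minus * form q plus)
  | plus => ((q : k) ^ 2 * ((q : k) ^ 2 + 1)) • (form q zero * form q plus)
  | minus => ((q : k) ^ 2 * ((q : k) ^ 2 + 1)) • (form q minus * form q zero)

theorem utri_mul {R : Type v} [Ring R] (a b c a' b' c' : R) :
    (!![a, b; 0, c] : Matrix (Fin 2) (Fin 2) R) * !![a', b'; 0, c'] =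
      !![a * a', a * b' + b * c'; 0, c * c'] := by
  simp

theorem utri_ext {R : Type v} [Ring R] {a b c a' b' c' : R} (h1 : a = a') (h2 : b = b')
    (h3 : c = c') : (!![a, b; 0, c] : Matrix (Fin 2) (Fin 2) R) = !![a', b'; 0, c'] := by
  rw [h1, h2, h3]

theorem utri_smul {R : Type v} [Ring R] [Algebra k R] (r : k) (a b c : R) :
    r • (!![a, b; 0, c] : Matrix (Fin 2) (Fin 2) R) = !![r • a, r • b; 0, r • c] := by
  ext i j; fin_cases i <;> fin_cases j <;> simp

theorem utri_add {R : Type v} [Ring R] (a b c a' b' c' : R) :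
    (!![a, b; 0, c] : Matrix (Fin 2) (Fin 2) R) + !![a', b'; 0, c'] =
      !![a + a', b + b'; 0, c + c'] := by
  ext i j; fin_cases i <;> fin_cases j <;> simp

theorem utri_sub {R : Type v} [Ring R] (a b c a' b' c' : R) :
    (!![a, b; 0, c] : Matrix (Fin 2) (Fin 2) R) - !![a', b'; 0, c'] =
      !![a - a', b - b'; 0, c - c'] := by
  ext i j; fin_cases i <;> fin_cases j <;> simp

/-- The matrices `[[±x, d x], [0, x]]` satisfy all the relations, so that `d` extends to `Ω(A)` as a
graded derivation. -/
theorem dHolds (q : kˣ) : OmegaHolds q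
    (fun g => (!![gen q g, dGen q g; 0, gen q g] : Matrix (Fin 2) (Fin 2) (Omega q)))
    (fun i => !![-form q i, dForm q i; 0, form q i]) := by
  have h := holds q
  have hq := q.ne_zero
  have ab := h.base.ab
  have ag := h.base.ag
  have bg := h.base.bg
  have bd := h.base.bd
  have gd := h.base.gd
  have ad : gen q al * gen q de = 1 + (q : k) • (gen q ga * gen q be) := by
    rw [← bg, ← h.base.det]; simp
  have da : gen q de * gen q al = 1 + (q : k)⁻¹ • (gen q ga * gen q be) := by
    have := h.base.ad
    rw [ad, bg, sub_smul] at this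
    have h2 := congrArg (fun z => z - (q : k) • (gen q ga * gen q be) +
      (q : k)⁻¹ • (gen q ga * gen q be)) this
    rw [add_sub_cancel_right] at h2
    rw [h2]; abel
  have wg : ∀ i g, form q i * gen q g = _ := h.comm
  have sq := h.sq
  have pm := h.pm
  have zm := h.zm
  have pz := h.pz
  have l : ∀ {a b c : Omega q} (x : Omega q), a * b = c → a * (b * x) = c * x :=
    fun x e => by rw [← mul_assoc, e]
  have wg' := fun i g x => l x (wg i g)
  have sq' := fun i x => l x (sq i)
  have pm' := fun x => l x pm
  have zm' := fun x => l x zm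
  have pz' := fun x => l x pz
  have ab' := fun x => l x ab
  have ag' := fun x => l x ag
  have bg' := fun x => l x bg
  have bd' := fun x => l x bd
  have gd' := fun x => l x gd
  have ad' := fun x => l x ad
  have da' := fun x => l x da
  have e0 : (0 : Matrix (Fin 2) (Fin 2) (Omega q)) = !![0, 0; 0, 0] := by
    ext i j; fin_cases i <;> fin_cases j <;> rfl
  have e1 : (1 : Matrix (Fin 2) (Fin 2) (Omega q)) = !![1, 0; 0, 1] := by
    ext i j; fin_cases i <;> fin_cases j <;> rfl
  have d1 : gen q al * gen q de = gen q de * gen q al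
      + ((q : k) - (q : k)⁻¹) • (gen q be * gen q ga) := h.base.ad
  have d2 := h.base.det
  refine ⟨⟨?_, ?_, ?_, ?_, ?_, ?_, ?_⟩, fun i g => ?_, fun i => ?_, ?_, ?_, ?_⟩
  all_goals simp only [utri_mul, utri_smul, utri_add, utri_sub, e0, e1]
  all_goals refine utri_ext ?_ ?_ ?_
  all_goals try first | assumption | exact sq i
  all_goals try simp only [neg_mul, mul_neg, neg_neg, sq, pm, zm, pz, wg, smul_neg, neg_zero]
  all_goals try
    first
    | (cases i <;> cases g)
    | cases i
  all_goals
    simp only [dGen, dForm, OneForm.wt, Gen.deg, mul_add, add_mul, mul_sub, sub_mul, wg, wg', mul_assoc,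
      sq, pm, zm, pz, sq', pm', zm', pz', ab', ag', bg', bd', gd', ad', da',
      smul_smul, zpow_neg, smul_mul_assoc, mul_smul_comm, one_mul, mul_zero, zero_mul, smul_zero, add_zero,
      zero_add, neg_mul, mul_neg, Units.val_inv_eq_inv_val, Units.val_zpow_eq_zpow_val, smul_add, smul_sub]
  all_goals norm_num
  all_goals try (match_scalars <;> field_simp <;> ring)

def dHom (q : kˣ) : Omega q →ₐ[k] Matrix (Fin 2) (Fin 2) (Omega q) := lift q _ _ (dHolds q)

/-- The exterior differential of `Ω(A)`. -/
def d (q : kˣ) : Omega q →ₗ[k] Omega q :=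
  Matrix.entryLinearMap k (Omega q) 0 1 ∘ₗ (dHom q).toLinearMap

/-- The automorphism `x ↦ (-1)^n x` on forms of degree `n`. -/
def parity (q : kˣ) : Omega q →ₗ[k] Omega q :=
  Matrix.entryLinearMap k (Omega q) 0 0 ∘ₗ (dHom q).toLinearMap

theorem dHom_eq (q : kˣ) (x : Omega q) : dHom q x = !![parity q x, d q x; 0, x] := by
  have key : dHom q x 1 0 = 0 ∧ dHom q x 1 1 = x := by
    induction x using induction with
    | hs c => rw [AlgHom.commutes]; constructor <;> simp [Matrix.algebraMap_matrix_apply]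
    | hg g => simp [dHom]
    | hf i => simp [dHom]
    | ha x y h1 h2 => simp [h1, h2]
    | hm x y h1 h2 => simp [Matrix.mul_apply, h1, h2]
  ext i j
  fin_cases i <;> fin_cases j
  · rfl
  · rfl
  · exact key.1
  · exact key.2

theorem parity_mul (q : kˣ) (x y : Omega q) : parity q (x * y) = parity q x * parity q y := by
  have h : dHom q (x * y) = _ := map_mul (dHom q) x y
  rw [dHom_eq, dHom_eq, dHom_eq, utri_mul] at h
  simpa using congrFun (congrFun h 0) 0

theorem d_mul (q : kˣ) (x y : Omega q) : d q (x * y) = parity q x * d q y + d q x * y := by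
  have h : dHom q (x * y) = _ := map_mul (dHom q) x y
  rw [dHom_eq, dHom_eq, dHom_eq, utri_mul] at h
  simpa using congrFun (congrFun h 0) 1

@[simp] theorem d_gen (q : kˣ) (g : Gen) : d q (gen q g) = dGen q g := by simp [d, dHom]

@[simp] theorem d_form (q : kˣ) (i : OneForm) : d q (form q i) = dForm q i := by simp [d, dHom]

@[simp] theorem d_scalar (q : kˣ) (c : k) : d q (algebraMap k _ c) = 0 := by
  simp [d, Matrix.algebraMap_matrix_apply]

@[simp] theorem parity_scalar (q : kˣ) (c : k) :
    parity q (algebraMap k _ c) = algebraMap k _ c := by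
  simp [parity, Matrix.algebraMap_matrix_apply]

@[simp] theorem parity_gen (q : kˣ) (g : Gen) : parity q (gen q g) = gen q g := by
  simp [parity, dHom]

@[simp] theorem parity_form (q : kˣ) (i : OneForm) : parity q (form q i) = -form q i := by
  simp [parity, dHom]

theorem d_d_aux (q : kˣ) (x : Omega q) :
    d q (d q x) = 0 ∧ parity q (d q x) = -d q (parity q x) ∧ parity q (parity q x) = x := by
  have h := holds q
  have hq := q.ne_zero
  have l : ∀ {a b c : Omega q} (x : Omega q), a * b = c → a * (b * x) = c * x :=
    fun x e => by rw [← mul_assoc, e]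
  have wg : ∀ i g, form q i * gen q g = _ := h.comm
  have wg' := fun i g x => l x (wg i g)
  have sq := h.sq
  have pm := h.pm
  have zm := h.zm
  have pz := h.pz
  have sq' := fun i x => l x (sq i)
  have pm' := fun x => l x pm
  have zm' := fun x => l x zm
  have pz' := fun x => l x pz
  induction x using induction with
  | hs c => simp
  | ha x y h1 h2 =>
    refine ⟨?_, ?_, ?_⟩
    · rw [map_add, map_add, h1.1, h2.1, add_zero]
    · rw [map_add, map_add, map_add, map_add, h1.2.1, h2.2.1, neg_add]
    · rw [map_add, map_add, h1.2.2, h2.2.2]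
  | hm x y h1 h2 =>
    obtain ⟨a1, a2, a3⟩ := h1
    obtain ⟨b1, b2, b3⟩ := h2
    refine ⟨?_, ?_, ?_⟩
    · simp only [d_mul, map_add, a1, b1, a2, a3]
      simp
    · simp only [d_mul, parity_mul, map_add, a2, b2, a3]
      simp; abel
    · simp only [parity_mul, a3, b3]
  | hg g =>
    refine ⟨?_, ?_, by simp⟩
    · cases g <;> simp only [d_gen, d_form, dGen, dForm, map_add, map_sub, map_smul, d_mul,
        parity_gen, parity_form, mul_add, add_mul, mul_sub, sub_mul, mul_assoc, sq, pm, zm, pz,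
        smul_mul_assoc, mul_smul_comm, smul_smul, mul_zero, smul_add, smul_sub, smul_zero, add_zero,
        zero_add]
      all_goals match_scalars <;> ring
    · cases g <;> simp [dGen, parity_mul] <;> abel
  | hf i =>
    refine ⟨?_, ?_, by simp⟩
    · cases i <;> simp only [d_gen, d_form, dGen, dForm, map_add, map_sub, map_smul, d_mul,
        parity_gen, parity_form, mul_add, add_mul, mul_sub, sub_mul, mul_assoc, sq, pm, zm, pz, sq',
        pm', zm', pz', neg_mul, mul_neg,
        smul_mul_assoc, mul_smul_comm, smul_smul, mul_zero, zero_mul, smul_add, smul_sub, smul_zero, add_zero,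
        zero_add, neg_zero]
      all_goals match_scalars <;> ring
    · cases i <;> simp [dForm, parity_mul]

theorem d_d (q : kˣ) (x : Omega q) : d q (d q x) = 0 := (d_d_aux q x).1

/-- The inclusion of `A` in `Ω(A)`. -/
def incl (q : kˣ) : OqSL2 q →ₐ[k] Omega q := OqSL2.lift q (gen q) (holds q).base

@[simp] theorem incl_gen (q : kˣ) (g : Gen) : incl q (OqSL2.gen q g) = gen q g := by
  simp [incl]

end Omega

theorem OqSL2.induction (q : kˣ) {P : OqSL2 q → Prop} (hs : ∀ c : k, P (algebraMap k _ c))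
    (hg : ∀ g, P (gen q g))
    (ha : ∀ x y, P x → P y → P (x + y)) (hm : ∀ x y, P x → P y → P (x * y)) (x : OqSL2 q) :
    P x := by
  have hx : x ∈ Algebra.adjoin k (Set.range (gen q)) := by rw [adjoin_gen]; trivial
  induction hx using Algebra.adjoin_induction with
  | mem x h => obtain ⟨g, rfl⟩ := h; exact hg g
  | algebraMap c => exact hs c
  | add x y _ _ h1 h2 => exact ha _ _ h1 h2
  | mul x y _ _ h1 h2 => exact hm _ _ h1 h2

namespace Omega

/-- The automorphism `σ_i`, with `ω_i a = σ_i(a) ω_i`. -/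
def sigma (q : kˣ) (i : OneForm) : OqSL2 q →ₐ[k] OqSL2 q := OqSL2.scale q (q ^ (-i.wt))

theorem sigma_gen (q : kˣ) (i : OneForm) (g : Gen) :
    sigma q i (OqSL2.gen q g) = ((q ^ (-(i.wt * g.deg)) : kˣ) : k) • OqSL2.gen q g := by
  unfold sigma OqSL2.scale
  rw [OqSL2.lift_gen, ← zpow_mul, neg_mul]

theorem form_mul_incl (q : kˣ) (i : OneForm) (a : OqSL2 q) :
    form q i * incl q a = incl q (sigma q i a) * form q i := by
  induction a using OqSL2.induction with
  | hs c => simp only [AlgHom.commutes]; exact (Algebra.commutes c _).symm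
  | hg g => rw [incl_gen, (holds q).comm, sigma_gen, map_smul, incl_gen, smul_mul_assoc]
  | ha x y h1 h2 => simp only [map_add, mul_add, add_mul, h1, h2]
  | hm x y h1 h2 => rw [map_mul, ← mul_assoc, h1, mul_assoc, h2, map_mul, map_mul, mul_assoc]

theorem coefHolds (q : kˣ) (i : OneForm) : OmegaHolds q
    (fun g => (!![OqSL2.gen q g, 0; 0, sigma q i (OqSL2.gen q g)] :
      Matrix (Fin 2) (Fin 2) (OqSL2 q)))
    (fun j => open Classical in if j = i then !![0, 1; 0, 0] else 0) where
  base := by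
    have h := OqSL2.holds q
    have hs := h.map (sigma q i)
    have e1 : (1 : Matrix (Fin 2) (Fin 2) (OqSL2 q)) = !![1, 0; 0, 1] := by
      ext i j; fin_cases i <;> fin_cases j <;> rfl
    constructor
    all_goals simp only [utri_mul, utri_smul, utri_add, utri_sub, e1]
    all_goals refine utri_ext ?_ (by simp) ?_
    exacts [h.ab, hs.ab, h.ag, hs.ag, h.bg, hs.bg, h.bd, hs.bd, h.gd, hs.gd, h.ad, hs.ad,
      h.det, hs.det]
  comm j g := by
    split_ifs with hj
    · subst hj
      rw [utri_mul, utri_mul, utri_smul, sigma_gen]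
      refine utri_ext ?_ ?_ ?_ <;> simp
    · simp
  sq j := by
    split_ifs with hj
    · rw [utri_mul]
      ext i j; fin_cases i <;> fin_cases j <;> simp
    · simp
  pm := by cases i <;> simp
  zm := by cases i <;> simp
  pz := by cases i <;> simp

def coefHom (q : kˣ) (i : OneForm) : Omega q →ₐ[k] Matrix (Fin 2) (Fin 2) (OqSL2 q) :=
  lift q _ _ (coefHolds q i)

/-- The left coefficient of `ω_i` in a one-form `∑ a_i ω_i`. -/
def coef (q : kˣ) (i : OneForm) : Omega q →ₗ[k] OqSL2 q :=
  Matrix.entryLinearMap k (OqSL2 q) 0 1 ∘ₗ (coefHom q i).toLinearMap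

theorem coefHom_incl (q : kˣ) (i : OneForm) (a : OqSL2 q) :
    coefHom q i (incl q a) = !![a, 0; 0, sigma q i a] := by
  induction a using OqSL2.induction with
  | hs c =>
    simp only [AlgHom.commutes]
    ext i j; fin_cases i <;> fin_cases j <;> simp [Matrix.algebraMap_matrix_apply]
  | hg g => rw [incl_gen]; simp [coefHom]
  | ha x y h1 h2 => simp only [map_add, h1, h2, utri_add, add_zero]
  | hm x y h1 h2 => simp only [map_mul, h1, h2, utri_mul, mul_zero, zero_mul, add_zero]

theorem incl_injective (q : kˣ) : Function.Injective (incl q) := by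
  intro a b h
  have h1 := coefHom_incl q zero a
  rw [h, coefHom_incl] at h1
  simpa using (congrFun (congrFun h1 0) 0).symm

theorem coef_incl_mul_form (q : kˣ) (i j : OneForm) (a : OqSL2 q) :
    coef q i (incl q a * form q j) = open Classical in if j = i then a else 0 := by
  unfold coef
  rw [LinearMap.comp_apply, AlgHom.toLinearMap_apply, map_mul, coefHom_incl]
  by_cases h : j = i <;> simp [coefHom, h]

theorem degHolds (q : kˣ) : OmegaHolds q (fun g => Polynomial.monomial 0 (gen q g))
    (fun i => Polynomial.monomial 1 (form q i)) where
  base := (holds q).base.map Polynomial.CAlgHom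
  comm i g := by
    simp only [Polynomial.monomial_mul_monomial, Polynomial.smul_monomial, (holds q).comm,
      zero_add, add_zero]
  sq i := by simp only [Polynomial.monomial_mul_monomial, (holds q).sq, Polynomial.monomial_zero_right]
  pm := by simp only [Polynomial.monomial_mul_monomial, Polynomial.smul_monomial, (holds q).pm]
  zm := by simp only [Polynomial.monomial_mul_monomial, Polynomial.smul_monomial, (holds q).zm]
  pz := by simp only [Polynomial.monomial_mul_monomial, Polynomial.smul_monomial, (holds q).pz]

/-- The form degree, as an algebra map that sends an `n`-form `x` to `x X^n`. -/
def degHom (q : kˣ) : Omega q →ₐ[k] Polynomial (Omega q) := lift q _ _ (degHolds q)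

theorem degHom_incl (q : kˣ) (a : OqSL2 q) :
    degHom q (incl q a) = Polynomial.monomial 0 (incl q a) := by
  induction a using OqSL2.induction with
  | hs c => simp only [AlgHom.commutes]; rfl
  | hg g => rw [incl_gen]; simp [degHom]
  | ha x y h1 h2 => simp only [map_add, h1, h2]
  | hm x y h1 h2 => simp only [map_mul, h1, h2, Polynomial.monomial_mul_monomial]

end Omega

section Abstract

variable {R : Type v} [Ring R] [Algebra k R]

theorem mul_pow_comm_le {S V : Submodule k R} (hVS : V * S ≤ S * V) (n : ℕ) :
    V ^ n * S ≤ S * V ^ n := by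
  induction n with
  | zero => simp
  | succ n ih =>
    calc V ^ (n + 1) * S = V ^ n * (V * S) := by rw [pow_succ, mul_assoc]
      _ ≤ V ^ n * (S * V) := mul_le_mul' le_rfl hVS
      _ = V ^ n * S * V := (mul_assoc _ _ _).symm
      _ ≤ S * V ^ n * V := mul_le_mul' ih le_rfl
      _ = S * V ^ (n + 1) := by rw [pow_succ, mul_assoc]

theorem filtration_mul_le {S V : Submodule k R} (hS : S * S ≤ S) (hVS : V * S ≤ S * V)
    (m n : ℕ) : (S * V ^ m) * (S * V ^ n) ≤ S * V ^ (m + n) := by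
  calc (S * V ^ m) * (S * V ^ n) = S * (V ^ m * S) * V ^ n := by simp only [mul_assoc]
    _ ≤ S * (S * V ^ m) * V ^ n :=
        mul_le_mul' (mul_le_mul' le_rfl (mul_pow_comm_le hVS m)) le_rfl
    _ = (S * S) * V ^ (m + n) := by rw [pow_add]; simp only [mul_assoc]
    _ ≤ S * V ^ (m + n) := mul_le_mul' hS le_rfl

end Abstract

/-- A differential graded algebra over `A`: subspaces `forms n` of an algebra `W` whose sum is direct,
with `forms 0 = A`, closed under products, and a differential of degree one on them. -/
structure DGAlg (k : Type u) (A : Type v) (W : Type w) [Field k] [Ring A] [Algebra k A] [Ring W]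
    [Algebra k W] where
  incl : A →ₐ[k] W
  incl_injective : Function.Injective incl
  forms : ℕ → Submodule k W
  forms_zero : forms 0 = LinearMap.range incl.toLinearMap
  mul_mem : ∀ {m n : ℕ} {x y : W}, x ∈ forms m → y ∈ forms n → x * y ∈ forms (m + n)
  indep : iSupIndep forms
  d : W →ₗ[k] W
  d_mem : ∀ {n : ℕ} {x : W}, x ∈ forms n → d x ∈ forms (n + 1)
  d_mul : ∀ {m n : ℕ} {x y : W}, x ∈ forms m → y ∈ forms n →
    d (x * y) = d x * y + (-1 : k) ^ m • (x * d y)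
  d_d : ∀ {n : ℕ} {x : W}, x ∈ forms n → d (d x) = 0

namespace Omega

/-- The span of `ω_0, ω_+, ω_-`. -/
def invForms (q : kˣ) : Submodule k (Omega q) := Submodule.span k (Set.range (form q))

/-- The forms of degree `n` on `A`. -/
def formsA (q : kˣ) (n : ℕ) : Submodule k (Omega q) :=
  LinearMap.range (incl q).toLinearMap * invForms q ^ n

/-- The inclusion of the sphere in `Ω(A)`. -/
def inclB (q : kˣ) : podles q →ₐ[k] Omega q := (incl q).comp (podles q).val

/-- The forms of degree `n` on the sphere `B`: the span of all `b_0 d b_1 ... d b_n`. -/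
def formsB (q : kˣ) (n : ℕ) : Submodule k (Omega q) :=
  LinearMap.range (inclB q).toLinearMap *
    (LinearMap.range (inclB q).toLinearMap).map (d q) ^ n

theorem range_mul_le {A : Type v} {W : Type w} [Ring A] [Algebra k A] [Ring W] [Algebra k W]
    (f : A →ₐ[k] W) :
    LinearMap.range f.toLinearMap * LinearMap.range f.toLinearMap
      ≤ LinearMap.range f.toLinearMap := by
  rw [Submodule.mul_le]
  rintro _ ⟨a, rfl⟩ _ ⟨b, rfl⟩
  exact ⟨a * b, by simp⟩

theorem one_mem_range {A : Type v} {W : Type w} [Ring A] [Algebra k A] [Ring W] [Algebra k W]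
    (f : A →ₐ[k] W) : (1 : W) ∈ LinearMap.range f.toLinearMap := ⟨1, by simp⟩

theorem formsA_mul_mem (q : kˣ) {m n : ℕ} {x y : Omega q} (hx : x ∈ formsA q m)
    (hy : y ∈ formsA q n) : x * y ∈ formsA q (m + n) := by
  refine filtration_mul_le (range_mul_le _) ?_ m n (Submodule.mul_mem_mul hx hy)
  rw [Submodule.mul_le]
  rintro x hx _ ⟨a, rfl⟩
  induction hx using Submodule.span_induction with
  | mem x h =>
    obtain ⟨i, rfl⟩ := h
    rw [AlgHom.toLinearMap_apply, form_mul_incl]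
    exact Submodule.mul_mem_mul ⟨_, rfl⟩ (Submodule.subset_span ⟨i, rfl⟩)
  | zero => rw [zero_mul]; exact zero_mem _
  | add x y _ _ h1 h2 => rw [add_mul]; exact add_mem h1 h2
  | smul c x _ h => rw [smul_mul_assoc]; exact Submodule.smul_mem _ c h

theorem incl_mem (q : kˣ) (a : OqSL2 q) : incl q a ∈ formsA q 0 := by
  unfold formsA
  rw [pow_zero, mul_one]
  exact ⟨a, rfl⟩

theorem form_mem (q : kˣ) (i : OneForm) : form q i ∈ formsA q 1 := by
  unfold formsA
  rw [pow_one, ← one_mul (form q i)]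
  exact Submodule.mul_mem_mul (one_mem_range _) (Submodule.subset_span ⟨i, rfl⟩)

theorem gen_mem (q : kˣ) (g : Gen) : gen q g ∈ formsA q 0 := by
  rw [← incl_gen]; exact incl_mem q _

theorem parity_incl (q : kˣ) (a : OqSL2 q) : parity q (incl q a) = incl q a := by
  induction a using OqSL2.induction with
  | hs c => simp
  | hg g => simp
  | ha x y h1 h2 => simp only [map_add, h1, h2]
  | hm x y h1 h2 => simp only [map_mul, parity_mul, h1, h2]

theorem d_incl_mem (q : kˣ) (a : OqSL2 q) : d q (incl q a) ∈ formsA q 1 := by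
  induction a using OqSL2.induction with
  | hs c => simp
  | hg g =>
    have h : ∀ g i, gen q g * form q i ∈ formsA q 1 := fun g i => by
      have := formsA_mul_mem q (gen_mem q g) (form_mem q i)
      rwa [zero_add] at this
    rw [incl_gen, d_gen]
    cases g
    · exact sub_mem (h _ _) (Submodule.smul_mem _ _ (h _ _))
    · exact add_mem (Submodule.smul_mem _ _ (h _ _)) (h _ _)
    · exact sub_mem (h _ _) (Submodule.smul_mem _ _ (h _ _))
    · exact add_mem (Submodule.smul_mem _ _ (h _ _)) (h _ _)
  | ha x y h1 h2 => simp only [map_add]; exact add_mem h1 h2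
  | hm x y h1 h2 =>
    rw [map_mul, d_mul, parity_incl]
    refine add_mem ?_ ?_
    · simpa using formsA_mul_mem q (incl_mem q x) h2
    · simpa using formsA_mul_mem q h1 (incl_mem q y)

theorem formsA_induction (q : kˣ) {P : ℕ → Omega q → Prop} (h0 : ∀ a, P 0 (incl q a))
    (hadd : ∀ n x y, P n x → P n y → P n (x + y)) (hsmul : ∀ n (c : k) x, P n x → P n (c • x))
    (hmul : ∀ n x i, x ∈ formsA q n → P n x → P (n + 1) (x * form q i))
    (n : ℕ) (x : Omega q) (hx : x ∈ formsA q n) : P n x := by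
  induction n generalizing x with
  | zero =>
    unfold formsA at hx
    rw [pow_zero, mul_one] at hx
    obtain ⟨a, rfl⟩ := hx
    exact h0 a
  | succ n ih =>
    have e : formsA q (n + 1) = formsA q n * invForms q := by
      unfold formsA; rw [pow_succ, mul_assoc]
    rw [e] at hx
    induction hx using Submodule.mul_induction_on' with
    | mem_mul_mem y hy w hw =>
      induction hw using Submodule.span_induction with
      | mem w h =>
        obtain ⟨i, rfl⟩ := h
        exact hmul n y i hy (ih y hy)
      | zero =>
        have := hsmul _ 0 _ (hmul n y zero hy (ih y hy))
        rwa [zero_smul, ← mul_zero y] at this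
      | add a b _ _ h1 h2 => rw [mul_add]; exact hadd _ _ _ h1 h2
      | smul c a _ h => rw [mul_smul_comm]; exact hsmul _ _ _ h
    | add a _ b _ h1 h2 => exact hadd _ _ _ h1 h2

theorem parity_of_mem (q : kˣ) {n : ℕ} {x : Omega q} (hx : x ∈ formsA q n) :
    parity q x = (-1 : k) ^ n • x := by
  refine formsA_induction q (P := fun n x => parity q x = (-1 : k) ^ n • x) ?_ ?_ ?_ ?_ n x hx
  · intro a; simp [parity_incl]
  · intro n x y h1 h2; rw [map_add, h1, h2, smul_add]
  · intro n c x h; rw [map_smul, h, smul_comm]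
  · intro n x i _ h
    rw [parity_mul, h, parity_form, pow_succ, mul_neg_one, neg_smul, mul_neg, smul_mul_assoc]

theorem d_memA (q : kˣ) {n : ℕ} {x : Omega q} (hx : x ∈ formsA q n) : d q x ∈ formsA q (n + 1) := by
  refine formsA_induction q (P := fun n x => d q x ∈ formsA q (n + 1)) ?_ ?_ ?_ ?_ n x hx
  · exact d_incl_mem q
  · intro n x y h1 h2; rw [map_add]; exact add_mem h1 h2
  · intro n c x h; rw [map_smul]; exact Submodule.smul_mem _ _ h
  · intro n x i hx h
    rw [d_mul, parity_of_mem q hx, smul_mul_assoc, d_form]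
    have h2 : ∀ i j, form q i * form q j ∈ formsA q (1 + 1) := fun i j =>
      formsA_mul_mem q (form_mem q i) (form_mem q j)
    have h3 : dForm q i ∈ formsA q (1 + 1) := by
      cases i
      · exact Submodule.smul_mem _ _ (h2 _ _)
      · exact Submodule.smul_mem _ _ (h2 _ _)
      · exact Submodule.smul_mem _ _ (h2 _ _)
    have h4 : x * dForm q i ∈ formsA q (n + 1 + 1) := by
      rw [add_assoc]
      exact formsA_mul_mem q hx h3
    exact add_mem (Submodule.smul_mem _ _ h4) (formsA_mul_mem q h (form_mem q i))

theorem degHom_of_mem (q : kˣ) {n : ℕ} {x : Omega q} (hx : x ∈ formsA q n) :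
    degHom q x = Polynomial.monomial n x := by
  refine formsA_induction q (P := fun n x => degHom q x = Polynomial.monomial n x) ?_ ?_ ?_ ?_ n x hx
  · exact degHom_incl q
  · intro n x y h1 h2; rw [map_add, h1, h2, map_add]
  · intro n c x h; rw [map_smul, h, Polynomial.smul_monomial]
  · intro n x i _ h
    rw [map_mul, h, degHom, lift_form, Polynomial.monomial_mul_monomial]

theorem indepA (q : kˣ) : iSupIndep (formsA q) := by
  rw [iSupIndep_def]
  intro n
  rw [Submodule.disjoint_def]
  intro x hx hx'
  have h1 : (degHom q x).coeff n = x := by rw [degHom_of_mem q hx]; simp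
  have h2 : (⨆ (j) (_ : j ≠ n), formsA q j) ≤ LinearMap.ker
      ((Polynomial.lcoeff (Omega q) n).restrictScalars k ∘ₗ (degHom q).toLinearMap) := by
    refine iSup₂_le fun j hj y hy => ?_
    rw [LinearMap.mem_ker, LinearMap.comp_apply, AlgHom.toLinearMap_apply, degHom_of_mem q hy]
    simp [Polynomial.coeff_monomial, hj]
  have h3 := h2 hx'
  rw [LinearMap.mem_ker] at h3
  exact h1.symm.trans h3

theorem formsB_le (q : kˣ) (n : ℕ) : formsB q n ≤ formsA q n := by
  have hS : LinearMap.range (inclB q).toLinearMap ≤ formsA q 0 := by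
    rintro _ ⟨b, rfl⟩
    exact incl_mem q b
  induction n with
  | zero => unfold formsB; rw [pow_zero, mul_one]; exact hS
  | succ n ih =>
    have e : formsB q (n + 1) = formsB q n * (LinearMap.range (inclB q).toLinearMap).map (d q) := by
      unfold formsB; rw [pow_succ, mul_assoc]
    rw [e, Submodule.mul_le]
    rintro x hx _ ⟨y, hy, rfl⟩
    exact formsA_mul_mem q (ih hx) (d_memA q (hS hy))

theorem formsB_mul_mem (q : kˣ) {m n : ℕ} {x y : Omega q} (hx : x ∈ formsB q m)
    (hy : y ∈ formsB q n) : x * y ∈ formsB q (m + n) := by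
  refine filtration_mul_le (range_mul_le _) ?_ m n (Submodule.mul_mem_mul hx hy)
  rw [Submodule.mul_le]
  rintro _ ⟨_, ⟨b, rfl⟩, rfl⟩ _ ⟨c, rfl⟩
  have h := d_mul q (inclB q b) (inclB q c)
  have hp : parity q (inclB q b) = inclB q b := parity_incl q b
  rw [hp, ← map_mul, eq_comm, ← eq_sub_iff_add_eq'] at h
  simp only [AlgHom.toLinearMap_apply]
  rw [h]
  refine sub_mem ?_ (Submodule.mul_mem_mul ⟨b, rfl⟩ ⟨_, ⟨c, rfl⟩, rfl⟩)
  rw [← one_mul (d q _)]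
  exact Submodule.mul_mem_mul (one_mem_range _) ⟨_, ⟨b * c, rfl⟩, rfl⟩

theorem d_memB (q : kˣ) {n : ℕ} {x : Omega q} (hx : x ∈ formsB q n) : d q x ∈ formsB q (n + 1) := by
  have hd : ∀ b, d q (inclB q b) ∈ formsB q 1 := fun b => by
    unfold formsB
    rw [pow_one, ← one_mul (d q _)]
    exact Submodule.mul_mem_mul (one_mem_range _) ⟨_, ⟨b, rfl⟩, rfl⟩
  induction n generalizing x with
  | zero =>
    unfold formsB at hx
    rw [pow_zero, mul_one] at hx
    obtain ⟨b, rfl⟩ := hx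
    exact hd b
  | succ n ih =>
    have e : formsB q (n + 1) = formsB q n * (LinearMap.range (inclB q).toLinearMap).map (d q) := by
      unfold formsB; rw [pow_succ, mul_assoc]
    rw [e] at hx
    induction hx using Submodule.mul_induction_on' with
    | mem_mul_mem y hy w hw =>
      obtain ⟨_, ⟨b, rfl⟩, rfl⟩ := hw
      rw [d_mul, d_d, mul_zero, zero_add]
      exact formsB_mul_mem q (ih hy) (hd b)
    | add a _ b _ h1 h2 => rw [map_add]; exact add_mem h1 h2

end Omega

/-- The 3D calculus on `A = O_q(SL(2))`. -/
def calculus3D (q : kˣ) : DGAlg k (OqSL2 q) (Omega q) where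
  incl := Omega.incl q
  incl_injective := Omega.incl_injective q
  forms := Omega.formsA q
  forms_zero := by simp [Omega.formsA]
  mul_mem := Omega.formsA_mul_mem q
  indep := Omega.indepA q
  d := Omega.d q
  d_mem := Omega.d_memA q
  d_mul hx _ := by rw [Omega.d_mul, Omega.parity_of_mem q hx, smul_mul_assoc, add_comm]
  d_d _ := Omega.d_d q _

/-- The calculus on `B = O_q(S²)` induced by the 3D calculus. -/
def calculusSphere (q : kˣ) : DGAlg k (podles q) (Omega q) where
  incl := Omega.inclB q
  incl_injective := (Omega.incl_injective q).comp Subtype.val_injective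
  forms := Omega.formsB q
  forms_zero := by simp [Omega.formsB]
  mul_mem := Omega.formsB_mul_mem q
  indep := (Omega.indepA q).mono (Omega.formsB_le q)
  d := Omega.d q
  d_mem := Omega.d_memB q
  d_mul hx _ := by
    rw [Omega.d_mul, Omega.parity_of_mem q (Omega.formsB_le q _ hx), smul_mul_assoc, add_comm]
  d_d _ := Omega.d_d q _

namespace DGAlg

variable {A : Type v} {W : Type w} [Ring A] [Algebra k A] [Ring W] [Algebra k W]
  (E : DGAlg k A W)

theorem incl_mem (a : A) : E.incl a ∈ E.forms 0 := by
  rw [E.forms_zero]; exact ⟨a, rfl⟩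

theorem bimul_mem {n : ℕ} (a b : A) {x : W} (hx : x ∈ E.forms n) :
    E.incl a * x * E.incl b ∈ E.forms n := by
  have h := E.mul_mem (E.mul_mem (E.incl_mem a) hx) (E.incl_mem b)
  rwa [zero_add, add_zero] at h

/-- The bimodule structure of the forms: `x ↦ a x b`. -/
def bimul {n : ℕ} (a b : A) : E.forms n →ₗ[k] E.forms n where
  toFun x := ⟨E.incl a * (x : W) * E.incl b, E.bimul_mem a b x.2⟩
  map_add' x y := by ext; simp [mul_add, add_mul]
  map_smul' c x := by ext; simp

/-- The product of forms. -/
def wedge {m n : ℕ} (x : E.forms m) : E.forms n →ₗ[k] E.forms (m + n) where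
  toFun y := ⟨(x : W) * (y : W), E.mul_mem x.2 y.2⟩
  map_add' y z := by ext; simp [mul_add]
  map_smul' c y := by ext; simp

/-- The differential on forms of degree `n`. -/
def dForms (n : ℕ) : E.forms n →ₗ[k] E.forms (n + 1) where
  toFun x := ⟨E.d x, E.d_mem x.2⟩
  map_add' x y := by ext; simp
  map_smul' c x := by ext; simp

/-- The differential on the algebra. -/
def dAlg : A →ₗ[k] E.forms 1 where
  toFun a := ⟨E.d (E.incl a), E.d_mem (E.incl_mem a)⟩
  map_add' x y := by ext; simp
  map_smul' c x := by ext; simp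

/-- The right `A`-linear maps from `n`-forms to `A`. -/
def RHom (n : ℕ) : Submodule k (E.forms n →ₗ[k] A) where
  carrier := {f | ∀ (x : E.forms n) (a : A), f (E.bimul 1 a x) = f x * a}
  add_mem' hf hg x a := by simp only [LinearMap.add_apply, hf x a, hg x a, add_mul]
  zero_mem' x a := by simp
  smul_mem' c f hf x a := by simp only [LinearMap.smul_apply, hf x a, smul_mul_assoc]

/-- The bimodule structure of the right dual: `(a f b)(x) = a f(b x)`. -/
def dualBimul {n : ℕ} (a b : A) (f : E.RHom n) : E.RHom n :=
  ⟨LinearMap.mulLeft k a ∘ₗ f.1 ∘ₗ E.bimul b 1, fun x c => by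
    have h : E.bimul b 1 (E.bimul 1 c x) = E.bimul 1 c (E.bimul b 1 x) := by
      ext; simp [bimul, mul_assoc]
    simp only [LinearMap.comp_apply, LinearMap.mulLeft_apply]
    rw [h, f.2, mul_assoc]⟩

/-- The action of forms on the right duals: `(f x)(y) = f(x y)`. -/
def formAct {m n : ℕ} (f : E.RHom (m + n)) (x : E.forms m) : E.RHom n :=
  ⟨f.1 ∘ₗ E.wedge x, fun y c => by
    have h : E.wedge x (E.bimul 1 c y) = E.bimul 1 c (E.wedge x y) := by
      ext; simp [bimul, wedge, mul_assoc]
    simp only [LinearMap.comp_apply]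
    rw [h, f.2]⟩

/-- A right hom-connection on `A` itself. -/
structure HomConnection where
  toLin : E.RHom 1 →ₗ[k] A
  leibniz : ∀ (f : E.RHom 1) (a : A),
    toLin (E.dualBimul 1 a f) = toLin f * a + f.1 (E.dAlg a)

namespace HomConnection

variable {E} (N : E.HomConnection)

/-- The extension of a hom-connection to higher forms,
`N_n(f)(x) = N(f x) + (-1)^(n+1) f(d x)`. For `n = 0` this is `N` itself, with `Hom_A(A, A) = A`. -/
def higher (n : ℕ) (f : E.RHom (n + 1)) : E.RHom n :=
  ⟨{ toFun := fun x => N.toLin (E.formAct f x) + (-1 : k) ^ (n + 1) • f.1 (E.dForms n x)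
     map_add' := fun x y => by
      have h : E.formAct f (x + y) = E.formAct f x + E.formAct f y := by
        ext z
        change f.1 _ = f.1 _ + f.1 _
        rw [← map_add]; congr 1; ext; simp [wedge, add_mul]
      rw [h, map_add, map_add, map_add, smul_add]; abel
     map_smul' := fun c x => by
      have h : E.formAct f (c • x) = c • E.formAct f x := by
        ext z
        change f.1 _ = c • f.1 _
        rw [← map_smul]; congr 1; ext; simp [wedge]
      rw [h, map_smul, map_smul, map_smul, smul_add, smul_comm]; simp }, fun x a => by
    have h : E.formAct f (E.bimul 1 a x) = E.dualBimul 1 a (E.formAct f x) := by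
      ext z
      change f.1 _ = 1 * f.1 _
      rw [one_mul]; congr 1; ext; simp [wedge, bimul, mul_assoc]
    have h2 : E.dForms n (E.bimul 1 a x) =
        E.bimul 1 a (E.dForms n x) + (-1 : k) ^ n • E.wedge x (E.dAlg a) := by
      ext
      have := E.d_mul x.2 (E.incl_mem a)
      simpa [dForms, bimul, wedge, dAlg] using this
    change N.toLin _ + _ • f.1 _ = (N.toLin _ + _ • f.1 _) * a
    rw [h, N.leibniz, h2, map_add, map_smul, f.2, smul_add, smul_smul, ← pow_add]
    have h3 : (-1 : k) ^ (n + 1 + n) = -1 := by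
      rw [show n + 1 + n = 2 * n + 1 by ring, pow_succ, pow_mul]; simp
    have h4 : (E.formAct f x).1 (E.dAlg a) = f.1 (E.wedge x (E.dAlg a)) := rfl
    rw [h3, h4, add_mul, smul_mul_assoc, neg_one_smul]; abel⟩

/-- Flatness: the curvature `N ∘ N_1` vanishes. -/
def IsFlat : Prop := ∀ f : E.RHom 2, N.toLin (N.higher 1 f) = 0

/-- The complex of integral forms of `N` is isomorphic to the de Rham complex of `E`, where
`D`-forms correspond to degree `0`: there are linear isomorphisms `Ω^n ≅ Hom_A(Ω^m, A)` for all
`n + m = D` that intertwine the differentials, and all forms of degree above `D` vanish. -/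
def IntegralIsoDeRham (D : ℕ) : Prop :=
  (∀ n, D < n → E.forms n = ⊥) ∧
  ∃ e : ∀ n m : ℕ, n + m = D → (E.forms n ≃ₗ[k] E.RHom m),
    ∀ (n m : ℕ) (h : n + (m + 1) = D) (h' : n + 1 + m = D) (x : E.forms n),
      N.higher m (e n (m + 1) h x) = e (n + 1) m h' (E.dForms n x)

end HomConnection

end DGAlg

/-- The twisted derivations of the 3D calculus: `d a = ∑ i, (∂_i a) ω_i`. -/
def partialD (q : kˣ) (i : OneForm) : OqSL2 q →ₗ[k] OqSL2 q :=
  Omega.coef q i ∘ₗ Omega.d q ∘ₗ (Omega.incl q).toLinearMap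

/-- The one-form `ω_i`. -/
def oneForm (q : kˣ) (i : OneForm) : (calculus3D q).forms 1 := ⟨Omega.form q i, Omega.form_mem q i⟩

/-- The hom-connection of the 3D calculus,
`∇(f) = ∂_0(f(ω_0)) + q⁻² ∂_+(f(ω_+)) + q² ∂_-(f(ω_-))`. -/
def nabla3D (q : kˣ) (f : (calculus3D q).RHom 1) : OqSL2 q :=
  partialD q zero (f.1 (oneForm q zero)) + ((q : k)⁻¹ ^ 2) • partialD q plus (f.1 (oneForm q plus)) +
    ((q : k) ^ 2) • partialD q minus (f.1 (oneForm q minus))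

section Tensor

variable {B A W : Type u} [Ring B] [Algebra k B] [Ring A] [Algebra k A] [Ring W] [Algebra k W]

namespace DGAlg

/-- The module of one-forms `Ω¹`, as a type of its own. -/
def OneForms (E : DGAlg k B W) : Type u := E.forms 1

instance (E : DGAlg k B W) : AddCommGroup E.OneForms := inferInstanceAs (AddCommGroup (E.forms 1))

instance (E : DGAlg k B W) : Module k E.OneForms := inferInstanceAs (Module k (E.forms 1))

/-- The identity map. -/
def toOneForms (E : DGAlg k B W) : E.forms 1 ≃ₗ[k] E.OneForms := LinearEquiv.refl k (E.forms 1)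

/-- The relations `(x b) ⊗ a = x ⊗ (b a)`. -/
def balancing (E : DGAlg k B W) (i : B →ₐ[k] A) : Submodule k (E.OneForms ⊗[k] A) :=
  Submodule.span k {t | ∃ (x : E.forms 1) (b : B) (a : A),
    t = E.toOneForms (E.bimul 1 b x) ⊗ₜ[k] a - E.toOneForms x ⊗ₜ[k] (i b * a)}

/-- The balanced tensor product `Ω¹(B) ⊗_B A`. -/
abbrev BalTensor (E : DGAlg k B W) (i : B →ₐ[k] A) : Type u :=
  (E.OneForms ⊗[k] A) ⧸ E.balancing i

/-- The map `x ⊗ a ↦ x a` from `Ω¹(B) ⊗_B A` to the forms on `A`. -/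
def tensorToForms (E : DGAlg k B W) (i : B →ₐ[k] A) (j : A →ₐ[k] W)
    (h : ∀ b, E.incl b = j (i b)) : E.BalTensor i →ₗ[k] W :=
  (E.balancing i).liftQ
    (TensorProduct.lift ((LinearMap.mul k W).compl₁₂
      ((E.forms 1).subtype ∘ₗ E.toOneForms.symm.toLinearMap) j.toLinearMap)) (by
    refine Submodule.span_le.2 ?_
    rintro _ ⟨x, b, a, rfl⟩
    simp [bimul, h, mul_assoc])

/-- The map `x ⊗ a ↦ f(x) a` from `Ω¹(B) ⊗_B A` to `A`. -/
def hat (E : DGAlg k B W) (i : B →ₐ[k] A) (f : E.RHom 1) : E.BalTensor i →ₗ[k] A :=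
  (E.balancing i).liftQ
    (TensorProduct.lift ((LinearMap.mul k A).compl₁₂
      (i.toLinearMap ∘ₗ f.1 ∘ₗ E.toOneForms.symm.toLinearMap) LinearMap.id)) (by
    refine Submodule.span_le.2 ?_
    rintro _ ⟨x, b, a, rfl⟩
    have := f.2 x b
    simp [this, mul_assoc])

end DGAlg

end Tensor

/-- `Ω¹(B) ⊗_B A` for the sphere `B` in `A`. -/
abbrev SphereTensor (q : kˣ) : Type u := (calculusSphere q).BalTensor (podles q).val

/-- The map `j : Ω¹(B) ⊗_B A → Ω¹(A)`, `x ⊗ a ↦ x a`. -/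
def sphereJ (q : kˣ) : SphereTensor q →ₗ[k] Omega q :=
  (calculusSphere q).tensorToForms (podles q).val (Omega.incl q) (fun _ => rfl)

/-- The map `x ⊗ a ↦ f(x) a` on `Ω¹(B) ⊗_B A`. -/
def sphereHat (q : kˣ) (f : (calculusSphere q).RHom 1) : SphereTensor q →ₗ[k] OqSL2 q :=
  (calculusSphere q).hat (podles q).val f

/-- The elements `b_i` of degree `2`. -/
def bb (q : kˣ) : Fin 3 → OqSL2 q :=
  ![OqSL2.gen q al ^ 2, OqSL2.gen q ga ^ 2, OqSL2.gen q al * OqSL2.gen q ga]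

/-- The elements `a_i` of degree `-2`. -/
def aa (q : kˣ) : Fin 3 → OqSL2 q :=
  ![OqSL2.gen q de ^ 2, ((q : k) ^ 2) • OqSL2.gen q be ^ 2,
    (-((q : k) + (q : k)⁻¹)) • (OqSL2.gen q be * OqSL2.gen q de)]

/-- The scalars `q_i`. -/
def qq (q : kˣ) : Fin 3 → k := ![1, (q : k)⁻¹ ^ 4, (q : k)⁻¹ ^ 2]

/-- `Pi : Ω¹(A) → Ω¹(B) ⊗_B A` is the section of `j : Ω¹(B) ⊗_B A → Ω¹(A)` for which `j ∘ Pi` is the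
projection of `Ω¹(A)` along `ω_0 A`. -/
def IsHorizontalSection (q : kˣ) (Pi : (calculus3D q).forms 1 →ₗ[k] SphereTensor q) : Prop :=
  (∀ (x : (calculus3D q).forms 1) (t : SphereTensor q), (x : Omega q) = sphereJ q t → Pi x = t) ∧
  (∀ (x : (calculus3D q).forms 1) (a b c : OqSL2 q),
    (x : Omega q) = Omega.form q minus * Omega.incl q a + Omega.form q zero * Omega.incl q b
      + Omega.form q plus * Omega.incl q c →
    sphereJ q (Pi x) = Omega.form q minus * Omega.incl q a + Omega.form q plus * Omega.incl q c)

/-- `N` is the descended hom-connection `f ↦ ∇(hat f ∘ Pi)`. -/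
def IsDescended (q : kˣ) (Pi : (calculus3D q).forms 1 →ₗ[k] SphereTensor q)
    (N : (calculusSphere q).HomConnection) : Prop :=
  ∀ f : (calculusSphere q).RHom 1, ∃ F : (calculus3D q).RHom 1,
    F.1 = sphereHat q f ∘ₗ Pi ∧ ((N.toLin f : podles q) : OqSL2 q) = nabla3D q F

/-- The sub-bimodule of one-forms generated by three elements. -/
def bimodSpan (q : kˣ) (w : Fin 3 → (calculusSphere q).forms 1) :
    Submodule k ((calculusSphere q).forms 1) :=
  Submodule.span k {x | ∃ (i : Fin 3) (b c : podles q), x = (calculusSphere q).bimul b c (w i)}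

end QSphere


end

open QSphere QSphere.OneForm

noncomputable section

namespace QSphere

universe u v w

open Gen OneForm

variable {k : Type u} [Field k]

/-! ### The grading of `A`, read off from the coaction. -/

namespace OqSL2

/-! Everything reduces to three graded pieces of `A`: `B = A_0` and the `B`-bimodules `A_2` and
`A_{-2}`. The derivation `∂_0` is determined by the degree, since `(1 - q⁻²) ∂_0 a = a - σ_0(a)`
(`smul_partialD_zero`). The assumption on `q` enters as `q² ≠ 1`, which lets one divide by `1 -
q⁻²`: then `∂_0` vanishes on `B` and is a known scalar on `A_{±2}`. Hence `db` involves only `ω_+`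
and `ω_-`, and `∂_+`, `∂_-` shift degrees by `-2` and `2`.

This gives `Ω¹(B) = ω_+ A_{-2} ⊕ ω_- A_2`. One inclusion is a degree count
(`exists_of_mem_formsB_one`); the other needs explicit elements of `A` that isolate `ω_-` or `ω_+`
from the differentials of three elements of `B` (`form_minus_mul_mem`, `form_plus_mul_mem`).
Likewise `Ω²(B) = ω_- ω_+ B`, and three factors `ω_±` always multiply to zero.

The partitions of unity `∑ b_i a_i = 1` and `∑ q_i a_i b_i = 1` (`sum_bb_mul_aa`, `sum_aa_mul_bb`)
make `A_2` and `A_{-2}` mutually inverse `B`-bimodules. They provide right generators `w_i`, `u_i`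
of `Ω¹(B)`, and identify a functional on `Ω¹(B)` with a pair `(s, t)` in `A_2 × A_{-2}`, acting by
`ω_+ p + ω_- r ↦ s p + t r` (`RHom_apply`, `mkDual`). They also give the inverse of `j` on the span
of `ω_± A`, hence `Π`. In these coordinates the descended connection is `(s, t) ↦ q⁻² ∂_+ s + q² ∂_-
t`.

Up to sign `Ψ` is the wedge pairing: `Ψ(x)(y) = -φ(x y)`, with coordinates `(-q² r, p)` for `x = ω_+
p + ω_- r`. Since `d x = ω_- ω_+ (q² ∂_- p - ∂_+ r)` (`d_of_degree`), the square on `Ω¹(B)` commutes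
by substitution. The other square is the twisted Leibniz rule for `∂_±` on products with elements of
`B`. Both squares together turn flatness into `d² = 0` and give the isomorphism of complexes. -/

theorem algHom_ext {q : kˣ} {R : Type v} [Ring R] [Algebra k R] {f g : OqSL2 q →ₐ[k] R}
    (h : ∀ x, f (gen q x) = g (gen q x)) : f = g := by
  refine AlgHom.ext_of_adjoin_eq_top (adjoin_gen q) ?_
  rintro _ ⟨x, rfl⟩
  exact h x

theorem scale_gen (q c : kˣ) (g : Gen) :
    scale q c (gen q g) = ((c ^ g.deg : kˣ) : k) • gen q g := by
  simp [scale]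

theorem coaction_gen (q : kˣ) (g : Gen) :
    coaction q (gen q g) = AddMonoidAlgebra.single g.deg (gen q g) := by
  simp [coaction]

theorem scale_scale (q c e : kˣ) (a : OqSL2 q) : scale q c (scale q e a) = scale q (c * e) a := by
  have h : (scale q c).comp (scale q e) = scale q (c * e) := by
    refine algHom_ext fun g => ?_
    simp only [AlgHom.comp_apply, scale_gen, map_smul, smul_smul]
    rw [mul_zpow, mul_comm, Units.val_mul]
  exact DFunLike.congr_fun h a

theorem scale_one (q : kˣ) (a : OqSL2 q) : scale q 1 a = a := by
  have h : scale q 1 = AlgHom.id k (OqSL2 q) := by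
    refine algHom_ext fun g => ?_
    simp [scale_gen]
  exact DFunLike.congr_fun h a

/-- The elements of degree `n`. -/
def comp (q : kˣ) (n : ℤ) : Submodule k (OqSL2 q) where
  carrier := {a | coaction q a = AddMonoidAlgebra.single n a}
  add_mem' {a b} ha hb := by
    change coaction q _ = _ at ha hb
    change coaction q _ = _
    rw [map_add, ha, hb, AddMonoidAlgebra.single_add]
  zero_mem' := by
    change coaction q _ = _
    simp
  smul_mem' c a ha := by
    change coaction q _ = _ at ha
    change coaction q _ = _
    rw [map_smul, ha, AddMonoidAlgebra.smul_single]

theorem mem_comp {q : kˣ} {n : ℤ} {a : OqSL2 q} :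
    a ∈ comp q n ↔ coaction q a = AddMonoidAlgebra.single n a := Iff.rfl

theorem gen_mem (q : kˣ) (g : Gen) : gen q g ∈ comp q g.deg := coaction_gen q g

theorem mul_mem {q : kˣ} {m n p : ℤ} {a b : OqSL2 q} (ha : a ∈ comp q m) (hb : b ∈ comp q n)
    (h : m + n = p) : a * b ∈ comp q p := by
  rw [mem_comp] at *
  rw [map_mul, ha, hb, AddMonoidAlgebra.single_mul_single, h]

/-- The evaluation of Laurent polynomials at a nonzero scalar. -/
def evalUnit (q c : kˣ) : (OqSL2 q)[T;T⁻¹] →ₐ[k] OqSL2 q :=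
  AddMonoidAlgebra.liftNCAlgHom (AlgHom.id k (OqSL2 q))
    (((algebraMap k (OqSL2 q)).toMonoidHom.comp (Units.coeHom k)).comp (zpowersHom kˣ c))
    (fun x y => Algebra.commute_algebraMap_right ((zpowersHom kˣ c y : kˣ) : k) x)

theorem evalUnit_single (q c : kˣ) (n : ℤ) (a : OqSL2 q) :
    evalUnit q c (AddMonoidAlgebra.single n a) = ((c ^ n : kˣ) : k) • a := by
  have : evalUnit q c (AddMonoidAlgebra.single n a) =
      a * algebraMap k (OqSL2 q) ((c ^ n : kˣ) : k) := by
    simp [evalUnit, -LaurentPolynomial.single_eq_C_mul_T]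
  rw [this, ← Algebra.commutes, Algebra.smul_def]

/-- Scaling by `c` is the coaction followed by evaluation at `z = c`, as one sees on generators.
This turns the twists `σ_i` into scalars on homogeneous elements. -/
theorem scale_of_mem {q : kˣ} (c : kˣ) {n : ℤ} {a : OqSL2 q} (ha : a ∈ comp q n) :
    scale q c a = ((c ^ n : kˣ) : k) • a := by
  have h : scale q c = (evalUnit q c).comp (coaction q) := by
    refine algHom_ext fun g => ?_
    simp [scale_gen, coaction_gen, evalUnit_single, -LaurentPolynomial.single_eq_C_mul_T]
  rw [h, AlgHom.comp_apply, mem_comp.1 ha, evalUnit_single]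

theorem mem_podles {q : kˣ} {a : OqSL2 q} : a ∈ podles q ↔ a ∈ comp q 0 := Iff.rfl

/-- The action of a map on the coefficients, followed by a shift of the degree. -/
def shiftMap (q : kˣ) (s : ℤ) (f : OqSL2 q →+ OqSL2 q) (x : (OqSL2 q)[T;T⁻¹]) : (OqSL2 q)[T;T⁻¹] :=
  AddMonoidAlgebra.map f x * AddMonoidAlgebra.single s 1

theorem shiftMap_single (q : kˣ) (s n : ℤ) (f : OqSL2 q →+ OqSL2 q) (a : OqSL2 q) :
    shiftMap q s f (AddMonoidAlgebra.single n a) = AddMonoidAlgebra.single (n + s) (f a) := by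
  simp [shiftMap, AddMonoidAlgebra.single_mul_single, -LaurentPolynomial.single_eq_C_mul_T]

theorem shiftMap_add (q : kˣ) (s : ℤ) (f : OqSL2 q →+ OqSL2 q) (x y : (OqSL2 q)[T;T⁻¹]) :
    shiftMap q s f (x + y) = shiftMap q s f x + shiftMap q s f y := by
  simp [shiftMap, AddMonoidAlgebra.map_add, add_mul]

theorem shiftMap_zero (q : kˣ) (s : ℤ) (f : OqSL2 q →+ OqSL2 q) :
    shiftMap q s f 0 = 0 := by
  simp [shiftMap]

/-- A twisted derivation of `A` extends coefficientwise to a twisted derivation of `A[z, z⁻¹]`.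
Compatibility of `∂_i` with the coaction can then be checked on generators. -/
theorem shiftMap_mul (q : kˣ) (s : ℤ) {f g : OqSL2 q →+ OqSL2 q}
    (h : ∀ a b, f (a * b) = a * f b + f a * g b) (x y : (OqSL2 q)[T;T⁻¹]) :
    shiftMap q s f (x * y) = x * shiftMap q s f y + shiftMap q s f x * shiftMap q 0 g y := by
  induction x using AddMonoidAlgebra.induction_linear with
  | zero => simp [shiftMap_zero]
  | add x x' h1 h2 => simp only [add_mul, shiftMap_add, h1, h2]; abel
  | single m a =>
    induction y using AddMonoidAlgebra.induction_linear with
    | zero => simp [shiftMap_zero]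
    | add y y' h1 h2 => simp only [mul_add, shiftMap_add, h1, h2]; abel
    | single n b =>
      simp only [AddMonoidAlgebra.single_mul_single, shiftMap_single, h,
        AddMonoidAlgebra.single_add]
      congr 2 <;> ring

theorem coaction_scale (q c : kˣ) (a : OqSL2 q) :
    coaction q (scale q c a) = shiftMap q 0 (scale q c : OqSL2 q →+ OqSL2 q) (coaction q a) := by
  have h : (coaction q).comp (scale q c) =
      (AddMonoidAlgebra.mapAlgHom ℤ (scale q c)).comp (coaction q) := by
    refine algHom_ext fun g => ?_
    simp [scale_gen, coaction_gen, AddMonoidAlgebra.smul_single,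
      -LaurentPolynomial.single_eq_C_mul_T]
  have h1 := DFunLike.congr_fun h a
  simp only [AlgHom.comp_apply] at h1
  rw [h1, shiftMap, ← AddMonoidAlgebra.one_def, mul_one]
  rfl

end OqSL2

open OqSL2

/-! ### Normal ordering in `A` and the two partitions of unity. -/

section Identities

variable (q : kˣ)

/-- The rules from here to `de_al` are oriented so that rewriting moves `γ` and then `β` to the left
and removes every adjacent pair of `α` and `δ`. Identities in `A` become comparisons of coefficients
of words `γ^i β^j α^l` and `γ^i β^j δ^l`. -/
theorem be_al : gen q al * gen q be = (q : k) • (gen q be * gen q al) := (holds q).ab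

theorem ga_al : gen q al * gen q ga = (q : k) • (gen q ga * gen q al) := (holds q).ag

theorem ga_be : gen q be * gen q ga = gen q ga * gen q be := (holds q).bg

theorem be_de : gen q de * gen q be = (q : k)⁻¹ • (gen q be * gen q de) := by
  rw [(holds q).bd, smul_smul, inv_mul_cancel₀ q.ne_zero, one_smul]

theorem ga_de : gen q de * gen q ga = (q : k)⁻¹ • (gen q ga * gen q de) := by
  rw [(holds q).gd, smul_smul, inv_mul_cancel₀ q.ne_zero, one_smul]

theorem al_de : gen q al * gen q de = 1 + (q : k) • (gen q ga * gen q be) := by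
  rw [← ga_be, ← (holds q).det]; simp

theorem de_al : gen q de * gen q al = 1 + (q : k)⁻¹ • (gen q ga * gen q be) := by
  have h := (holds q).ad
  rw [al_de, ga_be, sub_smul] at h
  rw [← sub_eq_iff_eq_add] at h
  rw [← h]; abel

/-- Products are kept associated to the right, so each ordering rule is also needed with a tail `x`.
-/
theorem mul_mul_of_eq {R : Type*} [Semigroup R] {a b c : R} (h : a * b = c) (x : R) :
    a * (b * x) = c * x := by
  rw [← mul_assoc, h]

/-- A quantum form of `(αδ - βγ)² = 1`: the three summands are the terms of the expanded square. -/
theorem sum_bb_mul_aa : ∑ i, bb q i * aa q i = 1 := by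
  have hq := q.ne_zero
  simp only [Fin.sum_univ_three, bb, aa, pow_two, Matrix.cons_val_zero, Matrix.cons_val_one,
    Matrix.cons_val, mul_assoc, smul_mul_assoc, mul_smul_comm, smul_smul,
    smul_add, add_mul, mul_add, one_mul, mul_one,
    be_al, ga_al, ga_be, be_de, ga_de, al_de, de_al,
    mul_mul_of_eq (be_al q), mul_mul_of_eq (ga_al q), mul_mul_of_eq (ga_be q), mul_mul_of_eq (be_de q),
    mul_mul_of_eq (ga_de q), mul_mul_of_eq (al_de q), mul_mul_of_eq (de_al q)]
  match_scalars <;> field_simp <;> ring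

/-- The same squared determinant in the opposite order; the weights `q_i` compensate for exchanging
the factors. -/
theorem sum_aa_mul_bb : ∑ i, qq q i • (aa q i * bb q i) = 1 := by
  have hq := q.ne_zero
  simp only [Fin.sum_univ_three, bb, aa, qq, pow_two, Matrix.cons_val_zero, Matrix.cons_val_one,
    Matrix.cons_val, mul_assoc, smul_mul_assoc, mul_smul_comm, smul_smul,
    smul_add, add_mul, mul_add, one_mul, mul_one,
    be_al, ga_al, ga_be, be_de, ga_de, al_de, de_al,
    mul_mul_of_eq (be_al q), mul_mul_of_eq (ga_al q), mul_mul_of_eq (ga_be q), mul_mul_of_eq (be_de q),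
    mul_mul_of_eq (ga_de q), mul_mul_of_eq (al_de q), mul_mul_of_eq (de_al q)]
  match_scalars <;> field_simp <;> ring

theorem aa_mem (i : Fin 3) : aa q i ∈ comp q (-2) := by
  have hb := gen_mem q be
  have hd := gen_mem q de
  fin_cases i
  · simpa [aa, pow_two] using mul_mem hd hd (p := -2) rfl
  · simpa [aa, pow_two] using Submodule.smul_mem _ (q * q : k) (mul_mem hb hb (p := -2) rfl)
  · exact Submodule.smul_mem _ _ (mul_mem hb hd (p := -2) rfl)

theorem bb_mem (i : Fin 3) : bb q i ∈ comp q 2 := by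
  have ha := gen_mem q al
  have hc := gen_mem q ga
  fin_cases i
  · simpa [bb, pow_two] using mul_mem ha ha (p := 2) rfl
  · simpa [bb, pow_two] using mul_mem hc hc (p := 2) rfl
  · exact mul_mem ha hc (p := 2) rfl

end Identities

/-! ### The twisted derivations `∂_i`: degrees, values, and elements of `A` that separate `∂_+` from
`∂_-`. -/

section Partial

theorem Omega.coef_incl_mul (q : kˣ) (i : OneForm) (a : OqSL2 q) (x : Omega q) :
    Omega.coef q i (Omega.incl q a * x) = a * Omega.coef q i x := by
  simp [Omega.coef, Omega.coefHom_incl, Matrix.mul_apply, -Matrix.cons_mul]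

theorem Omega.coef_mul_incl (q : kˣ) (i : OneForm) (a : OqSL2 q) (x : Omega q) :
    Omega.coef q i (x * Omega.incl q a) = Omega.coef q i x * Omega.sigma q i a := by
  simp [Omega.coef, Omega.coefHom_incl, Matrix.mul_apply]

theorem partialD_mul (q : kˣ) (i : OneForm) (a b : OqSL2 q) :
    partialD q i (a * b) = a * partialD q i b + partialD q i a * Omega.sigma q i b := by
  simp [partialD, Omega.d_mul, Omega.parity_incl, Omega.coef_incl_mul, Omega.coef_mul_incl]

theorem partialD_algebraMap (q : kˣ) (i : OneForm) (c : k) :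
    partialD q i (algebraMap k _ c) = 0 := by
  simp [partialD]

/-- The values of the twisted derivations on the generators. -/
def partialGen (q : kˣ) : OneForm → Gen → OqSL2 q
  | zero, al => gen q al
  | zero, be => (-(q : k) ^ 2) • gen q be
  | zero, ga => gen q ga
  | zero, de => (-(q : k) ^ 2) • gen q de
  | plus, al => (-(q : k)) • gen q be
  | plus, ga => (-(q : k)) • gen q de
  | minus, be => gen q al
  | minus, de => gen q ga
  | _, _ => 0

theorem partialD_gen (q : kˣ) (i : OneForm) (g : Gen) :
    partialD q i (gen q g) = partialGen q i g := by
  have h := Omega.coef_incl_mul_form q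
  have e : ∀ g, Omega.gen q g = Omega.incl q (gen q g) := fun g => (Omega.incl_gen q g).symm
  rw [partialD, LinearMap.comp_apply, LinearMap.comp_apply, AlgHom.toLinearMap_apply,
    Omega.incl_gen, Omega.d_gen]
  cases g <;> simp only [Omega.dGen, e, map_add, map_sub, map_smul, h] <;> cases i <;>
    simp [partialGen]

theorem sigma_of_mem {q : kˣ} (i : OneForm) {n : ℤ} {a : OqSL2 q} (ha : a ∈ comp q n) :
    Omega.sigma q i a = ((q ^ (-(i.wt * n)) : kˣ) : k) • a := by
  rw [Omega.sigma, scale_of_mem _ ha, ← zpow_mul, neg_mul]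

/-- The degree of `∂_i`. -/
def OneForm.shift : OneForm → ℤ
  | zero => 0
  | plus => -2
  | minus => 2

/-- Both sides obey the same twisted Leibniz rule, so the values on generators decide. -/
theorem coaction_partialD (q : kˣ) (i : OneForm) (a : OqSL2 q) :
    coaction q (partialD q i a) =
      shiftMap q i.shift (partialD q i : OqSL2 q →+ OqSL2 q) (coaction q a) := by
  induction a using OqSL2.induction with
  | hs c =>
    rw [partialD_algebraMap, AlgHom.commutes, map_zero]
    have : algebraMap k (OqSL2 q)[T;T⁻¹] c = AddMonoidAlgebra.single 0 (algebraMap k _ c) := rfl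
    rw [this, shiftMap_single]
    simp [partialD_algebraMap]
  | hg g =>
    rw [coaction_gen, shiftMap_single]
    simp only [AddMonoidHom.coe_coe, partialD_gen]
    cases i <;> cases g <;>
      simp [partialGen, coaction_gen, Gen.deg, OneForm.shift, AddMonoidAlgebra.smul_single,
        -LaurentPolynomial.single_eq_C_mul_T]
  | ha x y h1 h2 => rw [map_add, map_add, h1, h2, map_add, shiftMap_add]
  | hm x y h1 h2 =>
    rw [partialD_mul, map_add, map_mul, map_mul, h1, h2, map_mul,
      shiftMap_mul q i.shift (g := (Omega.sigma q i : OqSL2 q →+ OqSL2 q))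
        (by simpa using partialD_mul q i), Omega.sigma, coaction_scale]

theorem partialD_mem {q : kˣ} (i : OneForm) {m n : ℤ} {a : OqSL2 q} (ha : a ∈ comp q m)
    (h : m + i.shift = n) : partialD q i a ∈ comp q n := by
  rw [mem_comp, coaction_partialD, mem_comp.1 ha, shiftMap_single, h]
  rfl

/-- The map `a ↦ a - σ_0(a)` is itself a `σ_0`-twisted derivation, since `ab - σ_0(a)σ_0(b) = a(b -
σ_0(b)) + (a - σ_0(a))σ_0(b)`. It is therefore enough to compare the two sides on generators. -/
theorem smul_partialD_zero (q : kˣ) (a : OqSL2 q) :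
    (1 - (q : k)⁻¹ ^ 2) • partialD q zero a = a - Omega.sigma q zero a := by
  have hq := q.ne_zero
  induction a using OqSL2.induction with
  | hs c => simp [partialD_algebraMap]
  | hg g =>
    rw [partialD_gen, Omega.sigma_gen]
    cases g <;>
      simp only [partialGen, Gen.deg, OneForm.wt, mul_one, mul_neg, neg_neg, zpow_neg,
        Units.val_inv_eq_inv_val, Units.val_zpow_eq_zpow_val] <;>
      match_scalars <;> norm_num <;> field_simp <;> ring
  | ha x y h1 h2 => rw [map_add, smul_add, h1, h2, map_add]; abel
  | hm x y h1 h2 =>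
    rw [partialD_mul, smul_add, ← mul_smul_comm, ← smul_mul_assoc, h1, h2, map_mul]
    noncomm_ring

/-- The `∂_i` are defined by extracting coefficients; this confirms that the three coefficients
recover all of `da`. -/
theorem d_incl_eq (q : kˣ) (a : OqSL2 q) :
    Omega.d q (Omega.incl q a) = Omega.incl q (partialD q zero a) * Omega.form q zero
      + Omega.incl q (partialD q plus a) * Omega.form q plus
      + Omega.incl q (partialD q minus a) * Omega.form q minus := by
  induction a using OqSL2.induction with
  | hs c => simp [partialD_algebraMap]
  | hg g =>
    rw [Omega.incl_gen, Omega.d_gen, partialD_gen, partialD_gen, partialD_gen]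
    cases g <;> simp [partialGen, Omega.dGen, sub_eq_add_neg]
  | ha x y h1 h2 => simp only [map_add, h1, h2, add_mul]; abel
  | hm x y h1 h2 =>
    simp only [map_mul, Omega.d_mul, Omega.parity_incl, h1, h2, partialD_mul, map_add, add_mul,
      mul_add, mul_assoc, Omega.form_mul_incl]
    abel

/-- Generators of the sphere. -/
def sphereGen (q : kˣ) : Fin 3 → OqSL2 q :=
  ![gen q al * gen q be, gen q ga * gen q de, gen q ga * gen q be]

theorem sphereGen_mem (q : kˣ) (i : Fin 3) : sphereGen q i ∈ podles q := by
  rw [mem_podles]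
  fin_cases i
  · exact mul_mem (gen_mem q al) (gen_mem q be) rfl
  · exact mul_mem (gen_mem q ga) (gen_mem q de) rfl
  · exact mul_mem (gen_mem q ga) (gen_mem q be) rfl

/-- Coefficients that extract `ω_-` from the differentials of the generators of the sphere. -/
def minusCoef (q : kˣ) : Fin 3 → OqSL2 q :=
  ![gen q de ^ 2, ((q : k)⁻¹ ^ 2) • gen q be ^ 2, (-(1 + (q : k)⁻¹ ^ 2)) • (gen q be * gen q de)]

/-- Coefficients that extract `ω_+` from the differentials of the generators of the sphere. -/
def plusCoef (q : kˣ) : Fin 3 → OqSL2 q :=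
  ![-gen q ga ^ 2, (-(q : k)⁻¹ ^ 2) • gen q al ^ 2, (1 + (q : k)⁻¹ ^ 2) • (gen q al * gen q ga)]

theorem minusCoef_mem (q : kˣ) (i : Fin 3) : minusCoef q i ∈ comp q (-2) := by
  have hb := gen_mem q be
  have hd := gen_mem q de
  fin_cases i
  · simpa [minusCoef, pow_two] using mul_mem hd hd (p := -2) rfl
  · exact Submodule.smul_mem _ _ (by rw [pow_two]; exact mul_mem hb hb (p := -2) rfl)
  · exact Submodule.smul_mem _ _ (mul_mem hb hd (p := -2) rfl)

theorem plusCoef_mem (q : kˣ) (i : Fin 3) : plusCoef q i ∈ comp q 2 := by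
  have ha := gen_mem q al
  have hc := gen_mem q ga
  fin_cases i
  · simpa [plusCoef, pow_two] using mul_mem hc hc (p := 2) rfl
  · exact Submodule.smul_mem _ _ (by rw [pow_two]; exact mul_mem ha ha (p := 2) rfl)
  · exact Submodule.smul_mem _ _ (mul_mem ha hc (p := 2) rfl)

/-- On `αβ`, `γδ`, `γβ` the derivation `∂_-` takes values proportional to `α²`, `γ²`, `αγ`, and
`∂_+` values proportional to `β²`, `δ²`, `βδ`. In this and the next three identities, the sums equal
to `1` are again squared determinants, and the sums equal to `0` are quantum forms of `x²y² - 2xyxy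
+ y²x² = 0`. -/
theorem sum_minusCoef_mul_minus (q : kˣ) :
    ∑ i, minusCoef q i * partialD q minus (sphereGen q i) = 1 := by
  have hq := q.ne_zero
  simp only [Fin.sum_univ_three, sphereGen, minusCoef, plusCoef, pow_two, Matrix.cons_val_zero,
    Matrix.cons_val_one, Matrix.cons_val, partialD_mul, partialD_gen, partialGen, Omega.sigma_gen,
    Gen.deg, OneForm.wt, neg_neg, zpow_neg, zpow_one, Units.val_inv_eq_inv_val, mul_zero, zero_mul,
    add_zero, zero_add, smul_zero, neg_mul, mul_neg]
  simp only [neg_mul, mul_neg, neg_smul, smul_neg, mul_assoc, smul_mul_assoc, mul_smul_comm, smul_smul,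
    smul_add, add_mul, mul_add, one_mul, mul_one,
    be_al, ga_al, ga_be, be_de, ga_de, al_de, de_al,
    mul_mul_of_eq (be_al q), mul_mul_of_eq (ga_al q), mul_mul_of_eq (ga_be q), mul_mul_of_eq (be_de q),
    mul_mul_of_eq (ga_de q), mul_mul_of_eq (al_de q), mul_mul_of_eq (de_al q)]
  match_scalars <;> field_simp <;> ring

theorem sum_minusCoef_mul_plus (q : kˣ) :
    ∑ i, minusCoef q i * partialD q plus (sphereGen q i) = 0 := by
  have hq := q.ne_zero
  simp only [Fin.sum_univ_three, sphereGen, minusCoef, plusCoef, pow_two, Matrix.cons_val_zero,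
    Matrix.cons_val_one, Matrix.cons_val, partialD_mul, partialD_gen, partialGen, Omega.sigma_gen,
    Gen.deg, OneForm.wt, neg_neg, zpow_neg, zpow_one, Units.val_inv_eq_inv_val, mul_zero, zero_mul,
    add_zero, zero_add, smul_zero, neg_mul, mul_neg]
  simp only [neg_mul, mul_neg, neg_smul, smul_neg, mul_assoc, smul_mul_assoc, mul_smul_comm, smul_smul,
    smul_add, add_mul, mul_add, one_mul, mul_one,
    be_al, ga_al, ga_be, be_de, ga_de, al_de, de_al,
    mul_mul_of_eq (be_al q), mul_mul_of_eq (ga_al q), mul_mul_of_eq (ga_be q), mul_mul_of_eq (be_de q),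
    mul_mul_of_eq (ga_de q), mul_mul_of_eq (al_de q), mul_mul_of_eq (de_al q)]
  match_scalars <;> field_simp <;> ring

theorem sum_plusCoef_mul_plus (q : kˣ) :
    ∑ i, plusCoef q i * partialD q plus (sphereGen q i) = 1 := by
  have hq := q.ne_zero
  simp only [Fin.sum_univ_three, sphereGen, minusCoef, plusCoef, pow_two, Matrix.cons_val_zero,
    Matrix.cons_val_one, Matrix.cons_val, partialD_mul, partialD_gen, partialGen, Omega.sigma_gen,
    Gen.deg, OneForm.wt, neg_neg, zpow_neg, zpow_one, Units.val_inv_eq_inv_val, mul_zero, zero_mul,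
    add_zero, zero_add, smul_zero, neg_mul, mul_neg]
  simp only [neg_mul, mul_neg, neg_smul, smul_neg, mul_assoc, smul_mul_assoc, mul_smul_comm, smul_smul,
    smul_add, add_mul, mul_add, one_mul, mul_one,
    be_al, ga_al, ga_be, be_de, ga_de, al_de, de_al,
    mul_mul_of_eq (be_al q), mul_mul_of_eq (ga_al q), mul_mul_of_eq (ga_be q), mul_mul_of_eq (be_de q),
    mul_mul_of_eq (ga_de q), mul_mul_of_eq (al_de q), mul_mul_of_eq (de_al q)]
  match_scalars <;> field_simp <;> ring

theorem sum_plusCoef_mul_minus (q : kˣ) :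
    ∑ i, plusCoef q i * partialD q minus (sphereGen q i) = 0 := by
  have hq := q.ne_zero
  simp only [Fin.sum_univ_three, sphereGen, minusCoef, plusCoef, pow_two, Matrix.cons_val_zero,
    Matrix.cons_val_one, Matrix.cons_val, partialD_mul, partialD_gen, partialGen, Omega.sigma_gen,
    Gen.deg, OneForm.wt, neg_neg, zpow_neg, zpow_one, Units.val_inv_eq_inv_val, mul_zero, zero_mul,
    add_zero, zero_add, smul_zero, neg_mul, mul_neg]
  simp only [neg_mul, mul_neg, neg_smul, smul_neg, mul_assoc, smul_mul_assoc, mul_smul_comm, smul_smul,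
    smul_add, add_mul, mul_add, one_mul, mul_one,
    be_al, ga_al, ga_be, be_de, ga_de, al_de, de_al,
    mul_mul_of_eq (be_al q), mul_mul_of_eq (ga_al q), mul_mul_of_eq (ga_be q), mul_mul_of_eq (be_de q),
    mul_mul_of_eq (ga_de q), mul_mul_of_eq (al_de q), mul_mul_of_eq (de_al q)]
  match_scalars <;> field_simp <;> ring

end Partial

/-! ### One-forms on the sphere: right coefficients, products and differentials. -/

namespace Omega

/-- The right coefficient of `ω_i` in a one-form `∑ ω_i a_i`. -/
def rcoef (q : kˣ) (i : OneForm) : Omega q →ₗ[k] OqSL2 q :=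
  (scale q (q ^ i.wt)).toLinearMap ∘ₗ coef q i

theorem scale_sigma (q : kˣ) (i : OneForm) (a : OqSL2 q) :
    scale q (q ^ i.wt) (sigma q i a) = a := by
  rw [sigma, scale_scale, ← zpow_add, add_neg_cancel, zpow_zero, scale_one]

theorem sigma_scale (q : kˣ) (i : OneForm) (a : OqSL2 q) :
    sigma q i (scale q (q ^ i.wt) a) = a := by
  rw [sigma, scale_scale, ← zpow_add, neg_add_cancel, zpow_zero, scale_one]

theorem rcoef_form_mul (q : kˣ) (i j : OneForm) (a : OqSL2 q) :
    rcoef q i (form q j * incl q a) = open Classical in if j = i then a else 0 := by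
  classical
  rw [rcoef, LinearMap.comp_apply, form_mul_incl, coef_incl_mul_form]
  split_ifs with h
  · subst h
    exact scale_sigma q _ a
  · simp

theorem rcoef_mul_incl (q : kˣ) (i : OneForm) (a : OqSL2 q) (x : Omega q) :
    rcoef q i (x * incl q a) = rcoef q i x * a := by
  simp [rcoef, coef_mul_incl, scale_sigma]

theorem incl_mul_form (q : kˣ) (i : OneForm) (a : OqSL2 q) :
    incl q a * form q i = form q i * incl q (scale q (q ^ i.wt) a) := by
  rw [form_mul_incl, sigma_scale]

theorem incl_mul_form_of_mem {q : kˣ} (i : OneForm) {n : ℤ} {a : OqSL2 q} (ha : a ∈ comp q n) :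
    incl q a * form q i = ((q ^ (i.wt * n) : kˣ) : k) • (form q i * incl q a) := by
  rw [incl_mul_form, scale_of_mem _ ha, map_smul, mul_smul_comm, ← zpow_mul]

/-- On degree `n` the twist `σ_0` is the scalar `q^(-2n)`, and `q² ≠ 1` permits division by `1 -
q⁻²`. -/
theorem partialD_zero_of_mem {q : kˣ} (h2 : (q : k) ^ 2 ≠ 1) {n : ℤ} {a : OqSL2 q}
    (ha : a ∈ comp q n) :
    partialD q zero a = ((1 - (q : k) ^ (-(2 * n))) / (1 - (q : k)⁻¹ ^ 2)) • a := by
  have h3 : 1 - (q : k)⁻¹ ^ 2 ≠ 0 := by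
    rw [inv_pow, sub_ne_zero]
    intro h
    exact h2 (inv_eq_one.1 h.symm)
  have h := smul_partialD_zero q a
  rw [sigma_of_mem _ ha] at h
  rw [div_eq_inv_mul, mul_smul, eq_inv_smul_iff₀ h3, h, sub_smul, one_smul,
    Units.val_zpow_eq_zpow_val]
  rfl

theorem partialD_zero_of_mem_podles {q : kˣ} (h2 : (q : k) ^ 2 ≠ 1) {a : OqSL2 q}
    (ha : a ∈ podles q) : partialD q zero a = 0 := by
  rw [partialD_zero_of_mem h2 (mem_podles.1 ha)]
  simp

theorem incl_mul_form_of_mem_podles {q : kˣ} (i : OneForm) {a : OqSL2 q} (ha : a ∈ podles q) :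
    incl q a * form q i = form q i * incl q a := by
  rw [incl_mul_form_of_mem i (mem_podles.1 ha)]
  simp

theorem d_incl_of_mem_podles {q : kˣ} (h2 : (q : k) ^ 2 ≠ 1) {a : OqSL2 q} (ha : a ∈ podles q) :
    d q (incl q a) = incl q (partialD q plus a) * form q plus
      + incl q (partialD q minus a) * form q minus := by
  rw [d_incl_eq, partialD_zero_of_mem_podles h2 ha]
  simp

theorem d_incl_of_mem_podles' {q : kˣ} (h2 : (q : k) ^ 2 ≠ 1) {a : OqSL2 q} (ha : a ∈ podles q) :
    d q (incl q a) = form q plus * incl q ((q : k)⁻¹ ^ 2 • partialD q plus a)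
      + form q minus * incl q ((q : k) ^ 2 • partialD q minus a) := by
  rw [d_incl_of_mem_podles h2 ha,
    incl_mul_form_of_mem plus (partialD_mem plus (mem_podles.1 ha) rfl),
    incl_mul_form_of_mem minus (partialD_mem minus (mem_podles.1 ha) rfl)]
  simp [OneForm.wt, OneForm.shift]

theorem incl_mul_d_mem {q : kˣ} {a b : OqSL2 q} (ha : a ∈ podles q) (hb : b ∈ podles q) :
    incl q a * d q (incl q b) ∈ formsB q 1 := by
  unfold formsB
  rw [pow_one]
  exact Submodule.mul_mem_mul ⟨⟨a, ha⟩, rfl⟩ ⟨_, ⟨⟨b, hb⟩, rfl⟩, rfl⟩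

/-- With the separating coefficients `c_i` and `x_i = αβ, γδ, γβ`, one has `r ω_- = ∑ (r c_i) d
x_i`. The factors `r c_i` have degree `2 - 2 = 0`, so they lie in `B`; moving `r` across `ω_-` costs
only a scalar. -/
theorem form_minus_mul_mem {q : kˣ} (h2 : (q : k) ^ 2 ≠ 1) {r : OqSL2 q} (hr : r ∈ comp q 2) :
    form q minus * incl q r ∈ formsB q 1 := by
  have h : incl q r * form q minus = ∑ i, incl q (r * minusCoef q i) * d q (incl q (sphereGen q i)) := by
    simp only [d_incl_of_mem_podles h2 (sphereGen_mem q _), mul_add, Finset.sum_add_distrib,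
      ← mul_assoc, ← map_mul, ← Finset.sum_mul, ← map_sum]
    simp only [mul_assoc, ← Finset.mul_sum, sum_minusCoef_mul_minus, sum_minusCoef_mul_plus]
    simp
  have h3 : incl q r * form q minus ∈ formsB q 1 := by
    rw [h]
    exact sum_mem fun i _ => incl_mul_d_mem
      (mem_podles.2 (OqSL2.mul_mem hr (minusCoef_mem q i) rfl)) (sphereGen_mem q i)
  rw [form_mul_incl, sigma_of_mem _ hr, map_smul, smul_mul_assoc]
  exact Submodule.smul_mem _ _ h3

theorem form_plus_mul_mem {q : kˣ} (h2 : (q : k) ^ 2 ≠ 1) {p : OqSL2 q} (hp : p ∈ comp q (-2)) :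
    form q plus * incl q p ∈ formsB q 1 := by
  have h : incl q p * form q plus = ∑ i, incl q (p * plusCoef q i) * d q (incl q (sphereGen q i)) := by
    simp only [d_incl_of_mem_podles h2 (sphereGen_mem q _), mul_add, Finset.sum_add_distrib,
      ← mul_assoc, ← map_mul, ← Finset.sum_mul, ← map_sum]
    simp only [mul_assoc, ← Finset.mul_sum, sum_plusCoef_mul_minus, sum_plusCoef_mul_plus]
    simp
  have h3 : incl q p * form q plus ∈ formsB q 1 := by
    rw [h]
    exact sum_mem fun i _ => incl_mul_d_mem
      (mem_podles.2 (OqSL2.mul_mem hp (plusCoef_mem q i) rfl)) (sphereGen_mem q i)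
  rw [form_mul_incl, sigma_of_mem _ hp, map_smul, smul_mul_assoc]
  exact Submodule.smul_mem _ _ h3

/-- For `b, c` in `B` the form `b dc` has no `ω_0` part, `b` commutes with `ω_±`, and `∂_± c` has
degree `∓2`. -/
theorem exists_of_mem_formsB_one {q : kˣ} (h2 : (q : k) ^ 2 ≠ 1) {x : Omega q}
    (hx : x ∈ formsB q 1) : ∃ p ∈ comp q (-2), ∃ r ∈ comp q 2,
      x = form q plus * incl q p + form q minus * incl q r := by
  unfold formsB at hx
  rw [pow_one] at hx
  induction hx using Submodule.mul_induction_on' with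
  | mem_mul_mem y hy w hw =>
    obtain ⟨⟨b, hb⟩, rfl⟩ := hy
    obtain ⟨_, ⟨⟨c, hc⟩, rfl⟩, rfl⟩ := hw
    have hc' := mem_podles.1 hc
    refine ⟨_, OqSL2.mul_mem (mem_podles.1 hb)
        (Submodule.smul_mem _ ((q : k)⁻¹ ^ 2) (partialD_mem plus hc' rfl)) rfl,
      _, OqSL2.mul_mem (mem_podles.1 hb)
        (Submodule.smul_mem _ ((q : k) ^ 2) (partialD_mem minus hc' rfl)) rfl, ?_⟩
    change incl q b * d q (incl q c) = _
    rw [d_incl_of_mem_podles' h2 hc, mul_add, ← mul_assoc, ← mul_assoc,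
      incl_mul_form_of_mem_podles _ hb, incl_mul_form_of_mem_podles _ hb, mul_assoc, mul_assoc,
      ← map_mul, ← map_mul]
  | add x _ y _ h1 h2 =>
    obtain ⟨p, hp, r, hr, rfl⟩ := h1
    obtain ⟨p', hp', r', hr', rfl⟩ := h2
    refine ⟨_, add_mem hp hp', _, add_mem hr hr', ?_⟩
    simp only [map_add, mul_add]
    abel

theorem eq_of_mem_formsB_one {q : kˣ} (h2 : (q : k) ^ 2 ≠ 1) {x : Omega q}
    (hx : x ∈ formsB q 1) : rcoef q plus x ∈ comp q (-2) ∧ rcoef q minus x ∈ comp q 2 ∧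
      x = form q plus * incl q (rcoef q plus x) + form q minus * incl q (rcoef q minus x) := by
  obtain ⟨p, hp, r, hr, rfl⟩ := exists_of_mem_formsB_one h2 hx
  simp [rcoef_form_mul, hp, hr]

/-- The squares of `ω_±` kill two of the four products. In the mixed terms, moving `r` past `ω_+`
gives `q²`, while moving `p` past `ω_-` gives `q⁻²`, which cancels against `ω_+ ω_- = -q² ω_- ω_+`.
-/
theorem mul_of_degree {q : kˣ} {p r : OqSL2 q} (hp : p ∈ comp q (-2)) (hr : r ∈ comp q 2)
    (a b : OqSL2 q) :
    (form q plus * incl q p + form q minus * incl q r) *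
      (form q plus * incl q a + form q minus * incl q b) =
    form q minus * form q plus * incl q ((q : k) ^ 2 • (r * a) - p * b) := by
  have hq := q.ne_zero
  have sq := fun i => mul_mul_of_eq ((holds q).sq i)
  have pm := mul_mul_of_eq (holds q).pm
  have cp := fun i => mul_mul_of_eq (incl_mul_form_of_mem i hp)
  have cr := fun i => mul_mul_of_eq (incl_mul_form_of_mem i hr)
  simp only [mul_add, add_mul, mul_assoc, cp, cr, mul_smul_comm, smul_mul_assoc, sq, pm, zero_mul,
    mul_zero, smul_zero, map_sub, mul_sub, map_smul, map_mul, OneForm.wt, smul_smul,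
    Units.val_zpow_eq_zpow_val]
  match_scalars <;> norm_num

/-- The terms with `ω_0` cancel: on degrees `-2` and `2` the derivation `∂_0` is the scalar `-q²(q²
+ 1)` and `1 + q⁻²`, which matches `dω_+` and `dω_-` after reordering. The terms with a repeated
`ω_±` vanish, and the surviving coefficients have degree `0`, so they commute with `ω_±`. -/
theorem d_of_degree {q : kˣ} (h2 : (q : k) ^ 2 ≠ 1) {p r : OqSL2 q} (hp : p ∈ comp q (-2))
    (hr : r ∈ comp q 2) :
    d q (form q plus * incl q p + form q minus * incl q r) =
      form q minus * form q plus * incl q ((q : k) ^ 2 • partialD q minus p - partialD q plus r) := by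
  have hq := q.ne_zero
  have h3 : (q : k) ^ 2 - 1 ≠ 0 := sub_ne_zero.2 h2
  have hp1 : incl q (partialD q plus p) * form q plus = _ :=
    incl_mul_form_of_mem plus (partialD_mem plus hp (n := -4) rfl)
  have hp2 : incl q (partialD q minus p) * form q minus = _ :=
    incl_mul_form_of_mem minus (partialD_mem minus hp (n := 0) rfl)
  have hr1 : incl q (partialD q plus r) * form q plus = _ :=
    incl_mul_form_of_mem plus (partialD_mem plus hr (n := 0) rfl)
  have hr2 : incl q (partialD q minus r) * form q minus = _ :=
    incl_mul_form_of_mem minus (partialD_mem minus hr (n := 4) rfl)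
  have hzp := incl_mul_form_of_mem zero hp
  have hzr := incl_mul_form_of_mem zero hr
  simp only [map_add, d_mul, parity_form, d_form, dForm, d_incl_eq, mul_add, hp1, hp2, hr1, hr2,
    partialD_zero_of_mem h2 hp, partialD_zero_of_mem h2 hr, map_smul, smul_mul_assoc, hzp, hzr,
    mul_smul_comm, ← mul_assoc, (holds q).sq, (holds q).pm, (holds q).pz, zero_mul, smul_zero,
    map_sub, mul_sub, OneForm.wt, smul_smul, Units.val_zpow_eq_zpow_val, neg_mul, smul_neg]
  match_scalars <;> norm_num <;> norm_cast <;> norm_num <;> (try field_simp) <;> (try ring)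

/-! ### Two-forms on the sphere and the vanishing of higher forms. -/

/-- The twists of `A` by the weights of `1, ω_-, ω_+, ω_- ω_+`. -/
def twist (q : kˣ) : Fin 4 → OqSL2 q →ₐ[k] OqSL2 q :=
  ![AlgHom.id k _, sigma q minus, sigma q plus, sigma q zero]

/-- The diagonal action of `A` by twists. -/
def twistHom (q : kˣ) : OqSL2 q →ₐ[k] Matrix (Fin 4) (Fin 4) (OqSL2 q) :=
  (Matrix.diagonalAlgHom k).comp (AlgHom.pi (twist q))

theorem twistHom_apply (q : kˣ) (a : OqSL2 q) :
    twistHom q a = Matrix.diagonal (fun i => twist q i a) := rfl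

/-- The action of the one-forms on the quotient of `Ω(A)` by `ω_0`, free over `A` with basis
`1, ω_-, ω_+, ω_- ω_+`. -/
def horizontalForm (q : kˣ) : OneForm → Matrix (Fin 4) (Fin 4) (OqSL2 q)
  | zero => 0
  -- Rows list the images of the basis `1, ω_-, ω_+, ω_- ω_+` under right multiplication; the entry
  -- `-q²` records `ω_+ ω_- = -q² ω_- ω_+`.
  | minus => !![0, 1, 0, 0; 0, 0, 0, 0; 0, 0, 0, (-(q : k) ^ 2) • 1; 0, 0, 0, 0]
  | plus => !![0, 0, 1, 0; 0, 0, 0, 1; 0, 0, 0, 0; 0, 0, 0, 0]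

/-- Since `Ω(A)` is given by generators and relations, it is not evident that `ω_- ω_+ b` determines
`b`. This matrix representation detects the coefficient. -/
theorem horizontalHolds (q : kˣ) :
    OmegaHolds q (fun g => twistHom q (OqSL2.gen q g)) (horizontalForm q) where
  base := (OqSL2.holds q).map (twistHom q)
  comm i g := by
    ext m n
    rw [twistHom_apply, Matrix.mul_diagonal, Matrix.smul_apply, Matrix.diagonal_mul]
    cases i <;> fin_cases m <;> fin_cases n <;> simp [horizontalForm, twist, sigma_gen]
    all_goals cases g <;> simp [OneForm.wt, Gen.deg, smul_smul, pow_two, mul_assoc]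
  sq i := by
    ext m n
    rw [Matrix.mul_apply, Fin.sum_univ_four]
    cases i <;> fin_cases m <;> fin_cases n <;> simp [horizontalForm]
  pm := by
    ext m n
    rw [Matrix.smul_apply, Matrix.mul_apply, Matrix.mul_apply, Fin.sum_univ_four, Fin.sum_univ_four]
    fin_cases m <;> fin_cases n <;> simp [horizontalForm, Algebra.smul_def]
  zm := by simp [horizontalForm]
  pz := by simp [horizontalForm]

/-- The right coefficient of `ω_- ω_+` in a two-form. -/
def topCoef (q : kˣ) : Omega q →ₗ[k] OqSL2 q :=
  -- The weight `2` of `ω_0` is also the total weight of `ω_- ω_+`, so this scaling turns the left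
  -- coefficient into the right one.
  (scale q (q ^ zero.wt)).toLinearMap ∘ₗ Matrix.entryLinearMap k (OqSL2 q) 0 3 ∘ₗ
    (lift q _ _ (horizontalHolds q)).toLinearMap

theorem topCoef_apply (q : kˣ) (a : OqSL2 q) :
    topCoef q (form q minus * form q plus * incl q a) = a := by
  have h : (lift q _ _ (horizontalHolds q)).comp (incl q) = twistHom q :=
    OqSL2.algHom_ext fun g => by simp
  have h1 : lift q _ _ (horizontalHolds q) (incl q a) = twistHom q a := DFunLike.congr_fun h a
  simp only [topCoef, LinearMap.comp_apply, AlgHom.toLinearMap_apply, map_mul, lift_form, h1]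
  rw [twistHom_apply, Matrix.entryLinearMap_apply, Matrix.mul_diagonal, Matrix.mul_apply,
    Fin.sum_univ_four]
  simp [horizontalForm, twist, scale_sigma]

theorem top_mul_incl {q : kˣ} {b : OqSL2 q} (hb : b ∈ podles q) (a : OqSL2 q) :
    incl q b * (form q minus * form q plus * incl q a) =
      form q minus * form q plus * incl q (b * a) := by
  rw [← mul_assoc, ← mul_assoc, incl_mul_form_of_mem_podles _ hb, mul_assoc (form q minus),
    incl_mul_form_of_mem_podles _ hb, map_mul]
  simp only [mul_assoc]

theorem form_minus_mul_form_plus_mul_mem {q : kˣ} (h2 : (q : k) ^ 2 ≠ 1) {b : OqSL2 q}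
    (hb : b ∈ podles q) : form q minus * form q plus * incl q b ∈ formsB q 2 := by
  -- Insert `∑ b_i a_i = 1` in front of `b` and split each summand into two one-forms on the sphere;
  -- `q⁻²` removes the factor from moving `b_i` past `ω_+`.
  have h1 : form q minus * form q plus * incl q b =
      ∑ i, (q : k)⁻¹ ^ 2 • (form q minus * incl q (bb q i)) * (form q plus * incl q (aa q i * b)) := by
    have e : ∀ i, (q : k)⁻¹ ^ 2 • (form q minus * incl q (bb q i)) *
        (form q plus * incl q (aa q i * b)) =
        form q minus * form q plus * incl q (bb q i * aa q i * b) := fun i => by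
      have := mul_of_degree (zero_mem _) (bb_mem q i) (aa q i * b) 0
      simp only [map_zero, mul_zero, zero_add, add_zero, zero_mul, sub_zero] at this
      rw [smul_mul_assoc, this, map_smul, mul_smul_comm, smul_smul, ← mul_pow,
        inv_mul_cancel₀ q.ne_zero, one_pow, one_smul, mul_assoc (bb q i)]
    simp only [e, ← Finset.mul_sum, ← map_sum, ← Finset.sum_mul, sum_bb_mul_aa, one_mul]
  rw [h1]
  refine sum_mem fun i _ => formsB_mul_mem q (m := 1) (n := 1)
    (Submodule.smul_mem _ _ (form_minus_mul_mem h2 (bb_mem q i)))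
    (form_plus_mul_mem h2 (OqSL2.mul_mem (aa_mem q i) (mem_podles.1 hb) rfl))

theorem formsB_succ (q : kˣ) (n : ℕ) : formsB q (n + 1) ≤ formsB q n * formsB q 1 := by
  have h : (LinearMap.range (inclB q).toLinearMap).map (d q) ≤ formsB q 1 := by
    unfold formsB
    rw [pow_one]
    intro x hx
    rw [← one_mul x]
    exact Submodule.mul_mem_mul (one_mem_range _) hx
  calc formsB q (n + 1)
      = formsB q n * (LinearMap.range (inclB q).toLinearMap).map (d q) := by
        unfold formsB; rw [pow_succ, mul_assoc]
    _ ≤ _ := mul_le_mul' le_rfl h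

theorem exists_of_mem_formsB_two {q : kˣ} (h2 : (q : k) ^ 2 ≠ 1) {x : Omega q}
    (hx : x ∈ formsB q 2) : ∃ b ∈ podles q, x = form q minus * form q plus * incl q b := by
  replace hx := formsB_succ q 1 hx
  induction hx using Submodule.mul_induction_on' with
  | mem_mul_mem y hy z hz =>
    obtain ⟨p, hp, r, hr, rfl⟩ := exists_of_mem_formsB_one h2 hy
    obtain ⟨p', hp', r', hr', rfl⟩ := exists_of_mem_formsB_one h2 hz
    exact ⟨_, sub_mem ((podles q).smul_mem (mem_podles.2 (OqSL2.mul_mem hr hp' rfl)) _)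
      (OqSL2.mul_mem hp hr' rfl), mul_of_degree hp hr _ _⟩
  | add x _ y _ h1 h2 =>
    obtain ⟨b, hb, rfl⟩ := h1
    obtain ⟨c, hc, rfl⟩ := h2
    exact ⟨b + c, add_mem hb hc, by rw [map_add, mul_add]⟩

theorem formsB_eq_bot {q : kˣ} (h2 : (q : k) ^ 2 ≠ 1) {n : ℕ} (hn : 2 < n) : formsB q n = ⊥ := by
  induction n, hn using Nat.le_induction with
  | base =>
    rw [eq_bot_iff]
    refine (formsB_succ q 2).trans (Submodule.mul_le.2 fun y hy z hz => ?_)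
    obtain ⟨b, hb, rfl⟩ := exists_of_mem_formsB_two h2 hy
    obtain ⟨p, hp, r, hr, rfl⟩ := exists_of_mem_formsB_one h2 hz
    -- Since `b` commutes with `ω_±`, only `ω_- ω_+²` and `ω_- ω_+ ω_- = -q² ω_-² ω_+` occur, and
    -- both are zero.
    have e : form q minus * form q plus * incl q b *
        (form q plus * incl q p + form q minus * incl q r) =
        form q minus * ((form q plus * form q plus) * incl q (b * p)) +
        form q minus * ((form q plus * form q minus) * incl q (b * r)) := by
      simp only [mul_add, map_mul, mul_assoc]
      simp only [← mul_assoc (incl q b), incl_mul_form_of_mem_podles _ hb, mul_assoc]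
    rw [Submodule.mem_bot, e, (holds q).sq, (holds q).pm, smul_mul_assoc, mul_smul_comm,
      ← mul_assoc, ← mul_assoc, ← mul_assoc, (holds q).sq]
    simp
  | succ n _ ih =>
    rw [eq_bot_iff]
    refine (formsB_succ q n).trans ?_
    rw [ih, Submodule.bot_mul]

end Omega

open Omega

/-! ### The decomposition of `Ω¹(B)` and its generators. -/

section OneForms

theorem sum_aa_mul_bb_mul (q : kˣ) (x : OqSL2 q) :
    ∑ i, qq q i • (aa q i * (bb q i * x)) = x := by
  have h := congrArg (· * x) (sum_aa_mul_bb q)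
  simpa only [Finset.sum_mul, smul_mul_assoc, mul_assoc, one_mul] using h

theorem sum_mul_aa_mul_bb (q : kˣ) (x : OqSL2 q) :
    ∑ i, qq q i • (x * (aa q i * bb q i)) = x := by
  have h := congrArg (x * ·) (sum_aa_mul_bb q)
  simpa only [Finset.mul_sum, mul_smul_comm, mul_one] using h

variable {q : kˣ} (h2 : (q : k) ^ 2 ≠ 1)

/-- The one-form `ω_+ p` on the sphere. -/
def plusForm : comp q (-2) →ₗ[k] (calculusSphere q).forms 1 where
  toFun p := ⟨form q plus * incl q p, form_plus_mul_mem h2 p.2⟩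
  map_add' x y := by ext; simp [mul_add]
  map_smul' c x := by ext; simp

/-- The one-form `ω_- r` on the sphere. -/
def minusForm : comp q 2 →ₗ[k] (calculusSphere q).forms 1 where
  toFun r := ⟨form q minus * incl q r, form_minus_mul_mem h2 r.2⟩
  map_add' x y := by ext; simp [mul_add]
  map_smul' c x := by ext; simp

/-- The right coefficient of `ω_+`. -/
def plusPart : (calculusSphere q).forms 1 →ₗ[k] comp q (-2) :=
  (rcoef q plus ∘ₗ Submodule.subtype _).codRestrict _ fun x => (eq_of_mem_formsB_one h2 x.2).1

/-- The right coefficient of `ω_-`. -/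
def minusPart : (calculusSphere q).forms 1 →ₗ[k] comp q 2 :=
  (rcoef q minus ∘ₗ Submodule.subtype _).codRestrict _ fun x => (eq_of_mem_formsB_one h2 x.2).2.1

theorem coe_plusPart (x : (calculusSphere q).forms 1) :
    (plusPart h2 x : OqSL2 q) = rcoef q plus x := rfl

theorem coe_minusPart (x : (calculusSphere q).forms 1) :
    (minusPart h2 x : OqSL2 q) = rcoef q minus x := rfl

theorem plusForm_add_minusForm (x : (calculusSphere q).forms 1) :
    plusForm h2 (plusPart h2 x) + minusForm h2 (minusPart h2 x) = x :=
  Subtype.ext (eq_of_mem_formsB_one h2 x.2).2.2.symm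

theorem rcoef_plus_plusForm (p : comp q (-2)) : rcoef q plus (plusForm h2 p) = p := by
  simp [plusForm, rcoef_form_mul]

theorem rcoef_minus_plusForm (p : comp q (-2)) : rcoef q minus (plusForm h2 p) = 0 := by
  simp [plusForm, rcoef_form_mul]

theorem rcoef_plus_minusForm (r : comp q 2) : rcoef q plus (minusForm h2 r) = 0 := by
  simp [minusForm, rcoef_form_mul]

theorem rcoef_minus_minusForm (r : comp q 2) : rcoef q minus (minusForm h2 r) = r := by
  simp [minusForm, rcoef_form_mul]

theorem coe_bimul {n : ℕ} (b c : podles q) (x : (calculusSphere q).forms n) :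
    ((calculusSphere q).bimul b c x : Omega q) = incl q b * x * incl q c := rfl

theorem incl_mul_formB_one {b : OqSL2 q} (hb : b ∈ podles q) (p r : OqSL2 q) :
    incl q b * (form q plus * incl q p + form q minus * incl q r) =
      form q plus * incl q (b * p) + form q minus * incl q (b * r) := by
  rw [mul_add, ← mul_assoc, ← mul_assoc, incl_mul_form_of_mem_podles _ hb,
    incl_mul_form_of_mem_podles _ hb, mul_assoc, mul_assoc, map_mul, map_mul]

/-- Elements of `B` commute with `ω_±`, so `Ω¹(B)` is `A_{-2} ⊕ A_2` as a bimodule and not merely as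
a right module. -/
theorem rcoef_bimul (h2 : (q : k) ^ 2 ≠ 1) (b c : podles q) (x : (calculusSphere q).forms 1) :
    rcoef q plus ((calculusSphere q).bimul b c x) = b * rcoef q plus x * c ∧
    rcoef q minus ((calculusSphere q).bimul b c x) = b * rcoef q minus x * c := by
  rw [coe_bimul, rcoef_mul_incl, rcoef_mul_incl]
  have h := (eq_of_mem_formsB_one h2 x.2).2.2
  rw [h, incl_mul_formB_one b.2]
  simp only [map_add, rcoef_form_mul]
  simp

theorem oneForm_ext (h2 : (q : k) ^ 2 ≠ 1) {x y : (calculusSphere q).forms 1}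
    (hp : rcoef q plus x = rcoef q plus y) (hm : rcoef q minus x = rcoef q minus y) : x = y := by
  have hx := (eq_of_mem_formsB_one h2 x.2).2.2
  have hy := (eq_of_mem_formsB_one h2 y.2).2.2
  rw [← hp, ← hm, ← hx] at hy
  exact Subtype.ext hy.symm

/-- The generator `w_i = ω_+ a_i`. -/
def wForm (i : Fin 3) : (calculusSphere q).forms 1 := plusForm h2 ⟨aa q i, aa_mem q i⟩

/-- The generator `u_i = ω_- b_i`. -/
def uForm (i : Fin 3) : (calculusSphere q).forms 1 := minusForm h2 ⟨bb q i, bb_mem q i⟩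

/-- The product of elements of degrees `2` and `-2`. -/
def bbMul (i : Fin 3) (p : comp q (-2)) : podles q :=
  ⟨bb q i * p, mem_podles.2 (OqSL2.mul_mem (bb_mem q i) p.2 rfl)⟩

/-- The product of elements of degrees `-2` and `2`. -/
def aaMul (i : Fin 3) (r : comp q 2) : podles q :=
  ⟨aa q i * r, mem_podles.2 (OqSL2.mul_mem (aa_mem q i) r.2 rfl)⟩

/-- Writing `p = ∑ q_i a_i (b_i p)` with `b_i p` in `B` shows that the `w_i` generate `ω_+ A_{-2}`
from the right. The companion for `ω_-` uses `∑ b_i a_i = 1`. -/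
theorem plusForm_eq_sum (p : comp q (-2)) :
    plusForm h2 p = ∑ i, qq q i • (calculusSphere q).bimul 1 (bbMul i p) (wForm h2 i) := by
  ext
  simp only [AddSubmonoidClass.coe_finsetSum, Submodule.coe_smul, coe_bimul, wForm, plusForm,
    LinearMap.coe_mk, AddHom.coe_mk, bbMul, OneMemClass.coe_one, map_one, one_mul, mul_assoc,
    ← map_mul, ← mul_smul_comm, ← map_smul, ← Finset.mul_sum, ← map_sum]
  conv_lhs => rw [← sum_aa_mul_bb_mul q (p : OqSL2 q)]
  simp only [smul_mul_assoc]

theorem minusForm_eq_sum (r : comp q 2) :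
    minusForm h2 r = ∑ i, (calculusSphere q).bimul 1 (aaMul i r) (uForm h2 i) := by
  ext
  simp only [AddSubmonoidClass.coe_finsetSum, Submodule.coe_smul, coe_bimul, uForm, minusForm,
    LinearMap.coe_mk, AddHom.coe_mk, aaMul, OneMemClass.coe_one, map_one, one_mul, mul_assoc,
    ← map_mul, ← Finset.mul_sum, ← map_sum]
  congr 2
  simp only [← mul_assoc, ← Finset.sum_mul, sum_bb_mul_aa, one_mul]

theorem bimodSpan_wForm : bimodSpan q (wForm h2) = LinearMap.range (plusForm h2) := by
  refine le_antisymm (Submodule.span_le.2 ?_) ?_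
  · rintro _ ⟨i, b, c, rfl⟩
    refine ⟨⟨b * aa q i * c, OqSL2.mul_mem (OqSL2.mul_mem (mem_podles.1 b.2) (aa_mem q i) rfl)
      (mem_podles.1 c.2) rfl⟩, oneForm_ext h2 ?_ ?_⟩
    · rw [(rcoef_bimul h2 b c _).1, wForm, rcoef_plus_plusForm, rcoef_plus_plusForm]
    · rw [(rcoef_bimul h2 b c _).2, wForm, rcoef_minus_plusForm, rcoef_minus_plusForm]
      simp
  · rintro _ ⟨p, rfl⟩
    rw [plusForm_eq_sum]
    exact sum_mem fun i _ => Submodule.smul_mem _ _ (Submodule.subset_span ⟨i, _, _, rfl⟩)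

theorem bimodSpan_uForm : bimodSpan q (uForm h2) = LinearMap.range (minusForm h2) := by
  refine le_antisymm (Submodule.span_le.2 ?_) ?_
  · rintro _ ⟨i, b, c, rfl⟩
    refine ⟨⟨b * bb q i * c, OqSL2.mul_mem (OqSL2.mul_mem (mem_podles.1 b.2) (bb_mem q i) rfl)
      (mem_podles.1 c.2) rfl⟩, oneForm_ext h2 ?_ ?_⟩
    · rw [(rcoef_bimul h2 b c _).1, uForm, rcoef_plus_minusForm, rcoef_plus_minusForm]
      simp
    · rw [(rcoef_bimul h2 b c _).2, uForm, rcoef_minus_minusForm, rcoef_minus_minusForm]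
  · rintro _ ⟨r, rfl⟩
    rw [minusForm_eq_sum]
    exact sum_mem fun i _ => Submodule.subset_span ⟨i, _, _, rfl⟩

theorem isCompl_bimodSpan : IsCompl (bimodSpan q (wForm h2)) (bimodSpan q (uForm h2)) := by
  rw [bimodSpan_wForm, bimodSpan_uForm]
  constructor
  · rw [Submodule.disjoint_def]
    rintro _ ⟨p, rfl⟩ ⟨r, hr⟩
    refine oneForm_ext h2 ?_ ?_
    · rw [← hr, rcoef_plus_minusForm]; simp
    · rw [rcoef_minus_plusForm]; simp
  · rw [codisjoint_iff, eq_top_iff]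
    intro x _
    rw [← plusForm_add_minusForm h2 x]
    exact Submodule.add_mem_sup ⟨_, rfl⟩ ⟨_, rfl⟩

end OneForms

/-! ### The dual of `Ω¹(B)` in coordinates, and `Ψ`. -/

section Dual

variable {q : kˣ} (h2 : (q : k) ^ 2 ≠ 1)

/-- The coefficient of a functional on one-forms along `ω_+`. -/
def dualPlus : (calculusSphere q).RHom 1 →ₗ[k] comp q 2 where
  toFun f := ∑ i, qq q i • ⟨f.1 (wForm h2 i) * bb q i,
    OqSL2.mul_mem (mem_podles.1 (f.1 (wForm h2 i)).2) (bb_mem q i) rfl⟩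
  map_add' f g := by
    ext
    simp [add_mul, Finset.sum_add_distrib]
  map_smul' c f := by
    ext
    simp [Finset.smul_sum, smul_comm c]

/-- The coefficient of a functional on one-forms along `ω_-`. -/
def dualMinus : (calculusSphere q).RHom 1 →ₗ[k] comp q (-2) where
  toFun f := ∑ i, ⟨f.1 (uForm h2 i) * aa q i,
    OqSL2.mul_mem (mem_podles.1 (f.1 (uForm h2 i)).2) (aa_mem q i) rfl⟩
  map_add' f g := by
    ext
    simp [add_mul, Finset.sum_add_distrib]
  map_smul' c f := by
    ext
    simp [Finset.smul_sum]

theorem coe_dualPlus (f : (calculusSphere q).RHom 1) :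
    (dualPlus h2 f : OqSL2 q) = ∑ i, qq q i • ((f.1 (wForm h2 i) : OqSL2 q) * bb q i) := by
  simp [dualPlus]

theorem coe_dualMinus (f : (calculusSphere q).RHom 1) :
    (dualMinus h2 f : OqSL2 q) = ∑ i, (f.1 (uForm h2 i) : OqSL2 q) * aa q i := by
  simp [dualMinus]

theorem dualPlus_sub (f g : (calculusSphere q).RHom 1) :
    dualPlus h2 (f - g) = dualPlus h2 f - dualPlus h2 g := by
  have h : ∀ x, ((f - g).1 x : OqSL2 q) = f.1 x - g.1 x := fun _ => rfl
  ext
  rw [AddSubgroupClass.coe_sub]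
  simp only [coe_dualPlus, h, sub_mul, smul_sub, Finset.sum_sub_distrib]

theorem dualMinus_sub (f g : (calculusSphere q).RHom 1) :
    dualMinus h2 (f - g) = dualMinus h2 f - dualMinus h2 g := by
  have h : ∀ x, ((f - g).1 x : OqSL2 q) = f.1 x - g.1 x := fun _ => rfl
  ext
  rw [AddSubgroupClass.coe_sub]
  simp only [coe_dualMinus, h, sub_mul, Finset.sum_sub_distrib]

/-- Expand `x` in the generators `w_i`, `u_i` and use right linearity. A functional is thus left
multiplication by one element of `A_2` and one of `A_{-2}`. -/
theorem RHom_apply (f : (calculusSphere q).RHom 1) (x : (calculusSphere q).forms 1) :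
    (f.1 x : OqSL2 q) = dualPlus h2 f * rcoef q plus x + dualMinus h2 f * rcoef q minus x := by
  conv_lhs => rw [← plusForm_add_minusForm h2 x, plusForm_eq_sum, minusForm_eq_sum]
  simp only [map_add, map_sum, map_smul, f.2 _ _, coe_dualPlus, coe_dualMinus]
  simp [Finset.sum_mul, bbMul, aaMul, coe_plusPart, coe_minusPart, mul_assoc]

/-- The functional on one-forms with given coefficients. -/
def mkDual (s : comp q 2) (t : comp q (-2)) : (calculusSphere q).RHom 1 :=
  ⟨(((LinearMap.mulLeft k (s : OqSL2 q)) ∘ₗ rcoef q plus +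
      (LinearMap.mulLeft k (t : OqSL2 q)) ∘ₗ rcoef q minus) ∘ₗ
        ((calculusSphere q).forms 1).subtype).codRestrict (podles q).toSubmodule fun x =>
        add_mem (mem_podles.2 (OqSL2.mul_mem s.2 (plusPart h2 x).2 rfl))
          (mem_podles.2 (OqSL2.mul_mem t.2 (minusPart h2 x).2 rfl)),
    fun x b => Subtype.ext (by
      have h := rcoef_bimul h2 1 b x
      change s * rcoef q plus ((calculusSphere q).bimul 1 b x : Omega q) +
          t * rcoef q minus ((calculusSphere q).bimul 1 b x : Omega q) =
        (s * rcoef q plus x + t * rcoef q minus x) * b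
      rw [h.1, h.2]
      simp [add_mul, mul_assoc])⟩

theorem mkDual_apply (s : comp q 2) (t : comp q (-2)) (x : (calculusSphere q).forms 1) :
    ((mkDual h2 s t).1 x : OqSL2 q) = s * rcoef q plus x + t * rcoef q minus x := rfl

theorem dualPlus_mkDual (s : comp q 2) (t : comp q (-2)) : dualPlus h2 (mkDual h2 s t) = s := by
  ext
  simp only [coe_dualPlus, mkDual_apply, wForm, rcoef_plus_plusForm, rcoef_minus_plusForm, mul_zero,
    add_zero, mul_assoc, sum_mul_aa_mul_bb]

theorem dualMinus_mkDual (s : comp q 2) (t : comp q (-2)) : dualMinus h2 (mkDual h2 s t) = t := by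
  ext
  simp only [coe_dualMinus, mkDual_apply, uForm, rcoef_plus_minusForm, rcoef_minus_minusForm,
    mul_zero, zero_add, mul_assoc, ← Finset.mul_sum, sum_bb_mul_aa, mul_one]

theorem RHom_ext {f g : (calculusSphere q).RHom 1} (hp : dualPlus h2 f = dualPlus h2 g)
    (hm : dualMinus h2 f = dualMinus h2 g) : f = g := by
  ext x
  rw [RHom_apply h2, RHom_apply h2, hp, hm]

theorem dual_dualBimul (a b : podles q) (f : (calculusSphere q).RHom 1) :
    (dualPlus h2 ((calculusSphere q).dualBimul a b f) : OqSL2 q) = a * dualPlus h2 f * b ∧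
    (dualMinus h2 ((calculusSphere q).dualBimul a b f) : OqSL2 q) = a * dualMinus h2 f * b := by
  have ha := mem_podles.1 a.2
  have hb := mem_podles.1 b.2
  have h : (calculusSphere q).dualBimul a b f =
      mkDual h2 ⟨a * dualPlus h2 f * b, OqSL2.mul_mem (OqSL2.mul_mem ha (dualPlus h2 f).2 rfl) hb rfl⟩
        ⟨a * dualMinus h2 f * b, OqSL2.mul_mem (OqSL2.mul_mem ha (dualMinus h2 f).2 rfl) hb rfl⟩ := by
    ext x
    have hx := rcoef_bimul h2 b 1 x
    rw [mkDual_apply]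
    change (a : OqSL2 q) * f.1 _ = _
    rw [RHom_apply h2, hx.1, hx.2]
    simp [mul_add, mul_assoc]
  rw [h, dualPlus_mkDual, dualMinus_mkDual]
  exact ⟨rfl, rfl⟩

/-- The isomorphism `Ω¹(B) ≅ Ω¹(B)^*`. -/
def psi : (calculusSphere q).forms 1 ≃ₗ[k] (calculusSphere q).RHom 1 where
  toFun x := mkDual h2 ((-(q : k) ^ 2) • minusPart h2 x) (plusPart h2 x)
  map_add' x y := by
    refine RHom_ext h2 ?_ ?_ <;> simp only [map_add, dualPlus_mkDual, dualMinus_mkDual, smul_add]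
  map_smul' c x := by
    refine RHom_ext h2 ?_ ?_ <;>
      simp only [map_smul, dualPlus_mkDual, dualMinus_mkDual, RingHom.id_apply]
    rw [smul_comm]
  invFun f := plusForm h2 (dualMinus h2 f) + minusForm h2 ((-(q : k)⁻¹ ^ 2) • dualPlus h2 f)
  left_inv x := by
    have hq := q.ne_zero
    conv_rhs => rw [← plusForm_add_minusForm h2 x]
    beta_reduce
    rw [dualPlus_mkDual, dualMinus_mkDual, smul_smul]
    congr 2
    field_simp
    simp
  right_inv f := by
    have hq := q.ne_zero
    refine RHom_ext h2 ?_ ?_ <;> simp only [dualPlus_mkDual, dualMinus_mkDual] <;> ext <;>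
      simp [coe_plusPart, coe_minusPart, rcoef_plus_plusForm, rcoef_minus_plusForm,
        rcoef_plus_minusForm, rcoef_minus_minusForm, smul_smul, hq]

/-- Compared with `mul_of_degree`, this is minus the coefficient of `ω_- ω_+` in the product `x y`.
-/
theorem psi_apply (x y : (calculusSphere q).forms 1) :
    ((psi h2 x).1 y : OqSL2 q) = rcoef q plus x * rcoef q minus y
      - (q : k) ^ 2 • (rcoef q minus x * rcoef q plus y) := by
  change ((mkDual h2 _ _).1 y : OqSL2 q) = _
  rw [mkDual_apply]
  simp [coe_plusPart, coe_minusPart]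
  abel

theorem dualPlus_psi (x : (calculusSphere q).forms 1) :
    (dualPlus h2 (psi h2 x) : OqSL2 q) = (-(q : k) ^ 2) • rcoef q minus x :=
  congrArg Subtype.val (dualPlus_mkDual h2 _ _)

theorem dualMinus_psi (x : (calculusSphere q).forms 1) :
    (dualMinus h2 (psi h2 x) : OqSL2 q) = rcoef q plus x :=
  congrArg Subtype.val (dualMinus_mkDual h2 _ _)

theorem psi_bimul (a b : podles q) (x : (calculusSphere q).forms 1) :
    psi h2 ((calculusSphere q).bimul a b x) = (calculusSphere q).dualBimul a b (psi h2 x) := by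
  have h := dual_dualBimul h2 a b (psi h2 x)
  have hx := rcoef_bimul h2 a b x
  refine RHom_ext h2 (Subtype.ext ?_) (Subtype.ext ?_)
  · rw [h.1, dualPlus_psi, dualPlus_psi, hx.2]
    simp
  · rw [h.2, dualMinus_psi, dualMinus_psi, hx.1]

/-- The dual element `w_i^*`. -/
def wDual (i : Fin 3) : (calculusSphere q).RHom 1 :=
  mkDual h2 (qq q i • ⟨bb q i, bb_mem q i⟩) 0

/-- The dual element `u_i^*`. -/
def uDual (i : Fin 3) : (calculusSphere q).RHom 1 :=
  mkDual h2 0 ⟨aa q i, aa_mem q i⟩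

theorem wDual_apply (i : Fin 3) (x : (calculusSphere q).forms 1) :
    ((wDual h2 i).1 x : OqSL2 q) = qq q i • (bb q i * rcoef q plus x) := by
  simp [wDual, mkDual_apply]

theorem uDual_apply (i : Fin 3) (x : (calculusSphere q).forms 1) :
    ((uDual h2 i).1 x : OqSL2 q) = aa q i * rcoef q minus x := by
  simp [uDual, mkDual_apply]

/-- The coordinates of `w_i^*` are `(q_i b_i, 0)` and those of `u_i^*` are `(0, a_i)`. The two
partitions of unity collapse the sums to `p` and `-q² r`. -/
theorem psi_eq_sum (x : (calculusSphere q).forms 1) :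
    psi h2 x = ∑ i, (calculusSphere q).dualBimul 1 ((wDual h2 i).1 x) (uDual h2 i)
      - ((q : k) ^ 2) •
        ∑ i, (qq q i)⁻¹ • (calculusSphere q).dualBimul 1 ((uDual h2 i).1 x) (wDual h2 i) := by
  have hq : ∀ i, qq q i ≠ 0 := by
    intro i
    have := q.ne_zero
    fin_cases i <;> simp [qq]
  have h : ∀ a f, (dualPlus h2 ((calculusSphere q).dualBimul 1 a f) : OqSL2 q) = _ :=
    fun a f => (dual_dualBimul h2 1 a f).1
  have h' : ∀ a f, (dualMinus h2 ((calculusSphere q).dualBimul 1 a f) : OqSL2 q) = _ :=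
    fun a f => (dual_dualBimul h2 1 a f).2
  have hw : ∀ i, dualPlus h2 (wDual h2 i) = _ := fun i => dualPlus_mkDual h2 _ _
  have hw' : ∀ i, dualMinus h2 (wDual h2 i) = _ := fun i => dualMinus_mkDual h2 _ _
  have hu : ∀ i, dualPlus h2 (uDual h2 i) = _ := fun i => dualPlus_mkDual h2 _ _
  have hu' : ∀ i, dualMinus h2 (uDual h2 i) = _ := fun i => dualMinus_mkDual h2 _ _
  refine RHom_ext h2 (Subtype.ext ?_) (Subtype.ext ?_)
  · rw [dualPlus_psi, dualPlus_sub]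
    simp only [map_sub, map_sum, map_smul, AddSubgroupClass.coe_sub, AddSubmonoidClass.coe_finsetSum,
      Submodule.coe_smul, h, hw, hu, uDual_apply, ZeroMemClass.coe_zero, mul_zero, zero_mul,
      Finset.sum_const_zero, zero_sub, OneMemClass.coe_one, one_mul, smul_mul_assoc,
      inv_smul_smul₀ (hq _), ← mul_assoc, ← Finset.sum_mul, sum_bb_mul_aa, neg_smul]
  · rw [dualMinus_psi, dualMinus_sub]
    simp only [map_sub, map_sum, map_smul, AddSubgroupClass.coe_sub, AddSubmonoidClass.coe_finsetSum,
      Submodule.coe_smul, h', hw', hu', wDual_apply, ZeroMemClass.coe_zero, mul_zero, zero_mul,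
      Finset.sum_const_zero, sub_zero, OneMemClass.coe_one, one_mul, mul_smul_comm, smul_zero,
      sum_aa_mul_bb_mul]

end Dual

/-! ### `Ω²(B)` and its dual as free bimodules of rank one. -/

section TwoForms

variable {q : kˣ} (h2 : (q : k) ^ 2 ≠ 1)

/-- The isomorphism `B ≅ Ω²(B)`, `b ↦ ω_- ω_+ b`. -/
def theta : podles q ≃ₗ[k] (calculusSphere q).forms 2 where
  toFun b := ⟨form q minus * form q plus * incl q b, form_minus_mul_form_plus_mul_mem h2 b.2⟩
  map_add' x y := by ext; simp [mul_add]
  map_smul' c x := by ext; simp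
  invFun x := ⟨topCoef q x, by
    obtain ⟨b, hb, h⟩ := exists_of_mem_formsB_two h2 x.2
    rw [h, topCoef_apply]
    exact hb⟩
  left_inv b := Subtype.ext (topCoef_apply q b)
  right_inv x := by
    obtain ⟨b, hb, h⟩ := exists_of_mem_formsB_two h2 x.2
    ext
    simp only [h, topCoef_apply]

theorem coe_theta (b : podles q) :
    (theta h2 b : Omega q) = form q minus * form q plus * incl q b := rfl

theorem theta_bimul (a b c : podles q) :
    theta h2 (a * c * b) = (calculusSphere q).bimul a b (theta h2 c) := by
  ext
  rw [coe_bimul, coe_theta, coe_theta, top_mul_incl a.2]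
  simp only [MulMemClass.coe_mul, map_mul, mul_assoc]

/-- The functional `ω_- ω_+ b ↦ b` on two-forms. -/
def phi : (calculusSphere q).RHom 2 :=
  ⟨(theta h2).symm.toLinearMap, fun x b => by
    obtain ⟨c, rfl⟩ := (theta h2).surjective x
    rw [← theta_bimul]
    simp⟩

theorem phi_theta (b : podles q) : (phi h2).1 (theta h2 b) = b := (theta h2).symm_apply_apply b

theorem RHom_two_apply (f : (calculusSphere q).RHom 2) (b : podles q) :
    f.1 (theta h2 b) = f.1 (theta h2 1) * b := by
  rw [← f.2, ← theta_bimul, one_mul, one_mul]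

theorem dualBimul_theta (a b c : podles q) (f : (calculusSphere q).RHom 2) :
    ((calculusSphere q).dualBimul a b f).1 (theta h2 c) = a * f.1 (theta h2 (b * c)) := by
  change a * f.1 _ = _
  rw [← theta_bimul, mul_one]

/-- The isomorphism `B ≅ Ω²(B)^*`, `b ↦ φ b`. -/
def thetaDual : podles q ≃ₗ[k] (calculusSphere q).RHom 2 where
  toFun b := (calculusSphere q).dualBimul 1 b (phi h2)
  map_add' x y := by
    ext z
    obtain ⟨c, rfl⟩ := (theta h2).surjective z
    change _ = ((((calculusSphere q).dualBimul 1 x (phi h2)).1 (theta h2 c) +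
      ((calculusSphere q).dualBimul 1 y (phi h2)).1 (theta h2 c) : podles q) : OqSL2 q)
    rw [dualBimul_theta, dualBimul_theta, dualBimul_theta, phi_theta, phi_theta, phi_theta]
    simp [add_mul]
  map_smul' r x := by
    ext z
    obtain ⟨c, rfl⟩ := (theta h2).surjective z
    change _ = ((r • ((calculusSphere q).dualBimul 1 x (phi h2)).1 (theta h2 c) : podles q) : OqSL2 q)
    rw [dualBimul_theta, dualBimul_theta, phi_theta, phi_theta]
    simp
  invFun f := f.1 (theta h2 1)
  left_inv b := by
    change ((calculusSphere q).dualBimul 1 b (phi h2)).1 (theta h2 1) = b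
    rw [dualBimul_theta, phi_theta, one_mul, mul_one]
  right_inv f := by
    ext z
    obtain ⟨c, rfl⟩ := (theta h2).surjective z
    rw [dualBimul_theta, phi_theta, RHom_two_apply h2 f c, one_mul]

theorem thetaDual_apply (b : podles q) :
    thetaDual h2 b = (calculusSphere q).dualBimul 1 b (phi h2) := rfl

theorem thetaDual_theta (b c : podles q) : (thetaDual h2 b).1 (theta h2 c) = b * c := by
  rw [thetaDual_apply, dualBimul_theta, phi_theta, one_mul]

theorem thetaDual_bimul (a b c : podles q) :
    thetaDual h2 (a * c * b) = (calculusSphere q).dualBimul a b (thetaDual h2 c) := by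
  ext z
  obtain ⟨e, rfl⟩ := (theta h2).surjective z
  rw [dualBimul_theta, thetaDual_theta, thetaDual_theta]
  simp only [mul_assoc]

end TwoForms

/-! ### The connection on the sphere, the two commuting squares and flatness. -/

section Connection

variable {q : kˣ} (h2 : (q : k) ^ 2 ≠ 1)

theorem rcoef_dAlg (h2 : (q : k) ^ 2 ≠ 1) (b : podles q) :
    rcoef q plus ((calculusSphere q).dAlg b) = (q : k)⁻¹ ^ 2 • partialD q plus b ∧
    rcoef q minus ((calculusSphere q).dAlg b) = (q : k) ^ 2 • partialD q minus b := by
  have h : ((calculusSphere q).dAlg b : Omega q) = _ := d_incl_of_mem_podles' h2 b.2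
  rw [h]
  simp only [map_add, rcoef_form_mul]
  simp

/-- The hom-connection on the sphere. -/
def sphereConnection : (calculusSphere q).HomConnection where
  toLin :=
    ((((q : k)⁻¹ ^ 2) • partialD q plus ∘ₗ (comp q 2).subtype ∘ₗ dualPlus h2) +
      ((q : k) ^ 2) • partialD q minus ∘ₗ (comp q (-2)).subtype ∘ₗ dualMinus h2).codRestrict
      (podles q).toSubmodule fun f =>
        add_mem (Submodule.smul_mem _ _ (partialD_mem (n := 0) plus (dualPlus h2 f).2 rfl))
          (Submodule.smul_mem _ _ (partialD_mem (n := 0) minus (dualMinus h2 f).2 rfl))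
  leibniz f a := by
    have hq := q.ne_zero
    have h := dual_dualBimul h2 1 a f
    have hd := rcoef_dAlg h2 a
    -- The twists are trivial on `B`, so the twisted Leibniz rule of `∂_±` becomes the ordinary rule
    -- required of a hom-connection.
    have hs : ∀ i, sigma q i (a : OqSL2 q) = a := fun i => by
      rw [sigma_of_mem i (mem_podles.1 a.2)]; simp
    ext
    change (q : k)⁻¹ ^ 2 • partialD q plus (dualPlus h2 _ : OqSL2 q) +
        (q : k) ^ 2 • partialD q minus (dualMinus h2 _ : OqSL2 q) =
      ((q : k)⁻¹ ^ 2 • partialD q plus (dualPlus h2 _ : OqSL2 q) +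
        (q : k) ^ 2 • partialD q minus (dualMinus h2 _ : OqSL2 q)) * a + f.1 _
    rw [RHom_apply h2, hd.1, hd.2, h.1, h.2, OneMemClass.coe_one, one_mul, one_mul, partialD_mul,
      partialD_mul, hs, hs]
    simp only [smul_add, add_mul, smul_mul_assoc, mul_smul_comm]
    abel

theorem coe_sphereConnection (f : (calculusSphere q).RHom 1) :
    ((sphereConnection h2).toLin f : OqSL2 q) =
      (q : k)⁻¹ ^ 2 • partialD q plus (dualPlus h2 f : OqSL2 q) +
        (q : k) ^ 2 • partialD q minus (dualMinus h2 f : OqSL2 q) := rfl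

theorem theta_sphereConnection_psi (x : (calculusSphere q).forms 1) :
    theta h2 ((sphereConnection h2).toLin (psi h2 x)) = (calculusSphere q).dForms 1 x := by
  ext
  obtain ⟨hp, hm, hx⟩ := eq_of_mem_formsB_one h2 x.2
  change _ = d q (x : Omega q)
  rw [coe_theta, coe_sphereConnection, dualPlus_psi, dualMinus_psi]
  conv_rhs => rw [hx, d_of_degree h2 hp hm]
  congr 2
  rw [map_smul, smul_smul, mul_neg, ← mul_pow, inv_mul_cancel₀ q.ne_zero, one_pow, neg_one_smul]
  abel

theorem DGAlg.formAct_apply {A : Type v} {W : Type w} [Ring A] [Algebra k A] [Ring W] [Algebra k W]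
    (E : DGAlg k A W) {m n : ℕ} (f : E.RHom (m + n)) (x : E.forms m) (y : E.forms n) :
    (E.formAct f x).1 y = f.1 (E.wedge x y) := rfl

/-- Since `φ(x y) = -Ψ(x)(y)` and `φ` commutes with `b`, the functional `(φ b) x` is `-b Ψ(x)`;
these are its coordinates. -/
theorem dual_formAct_thetaDual (b : podles q) (x : (calculusSphere q).forms 1) :
    (dualPlus h2 ((calculusSphere q).formAct (m := 1) (n := 1) (thetaDual h2 b) x) : OqSL2 q) =
      (q : k) ^ 2 • (b * rcoef q minus x) ∧
    (dualMinus h2 ((calculusSphere q).formAct (m := 1) (n := 1) (thetaDual h2 b) x) : OqSL2 q) =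
      -(b * rcoef q plus x) := by
  obtain ⟨hp, hm, hx⟩ := eq_of_mem_formsB_one h2 x.2
  have hb := mem_podles.1 b.2
  have h : (calculusSphere q).formAct (m := 1) (n := 1) (thetaDual h2 b) x =
      mkDual h2 ((q : k) ^ 2 • ⟨b * rcoef q minus x, OqSL2.mul_mem hb hm rfl⟩)
        (-⟨b * rcoef q plus x, OqSL2.mul_mem hb hp rfl⟩) := by
    ext y
    obtain ⟨hp', hm', hy⟩ := eq_of_mem_formsB_one h2 y.2
    have hz : (q : k) ^ 2 • (rcoef q minus (x : Omega q) * rcoef q plus y) -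
        rcoef q plus (x : Omega q) * rcoef q minus y ∈ podles q :=
      sub_mem ((podles q).smul_mem (mem_podles.2 (OqSL2.mul_mem hm hp' rfl)) _)
        (mem_podles.2 (OqSL2.mul_mem hp hm' rfl))
    have hw : (calculusSphere q).wedge x y = theta h2 ⟨_, hz⟩ := by
      ext
      rw [coe_theta, ← mul_of_degree hp hm, ← hx, ← hy]
      rfl
    rw [DGAlg.formAct_apply, hw, thetaDual_theta, mkDual_apply]
    simp [mul_add, mul_assoc, sub_eq_add_neg]
  rw [h, dualPlus_mkDual, dualMinus_mkDual]
  exact ⟨rfl, rfl⟩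

/-- Evaluated at `x`, the left side is `b ∇(Ψ x) - ∇(b Ψ x)`, because `φ(dx) = ∇(Ψ x)`. By the
twisted Leibniz rule only the terms that differentiate `b` survive, and they are the coordinates of
`Ψ(db)` paired with `x`. -/
theorem higher_thetaDual (b : podles q) :
    (sphereConnection h2).higher 1 (thetaDual h2 b) = psi h2 ((calculusSphere q).dAlg b) := by
  ext x
  have hq := q.ne_zero
  obtain ⟨hp, hm, hx⟩ := eq_of_mem_formsB_one h2 x.2
  have h := dual_formAct_thetaDual h2 b x
  have hd := rcoef_dAlg h2 b
  rw [psi_apply, hd.1, hd.2]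
  change (((sphereConnection h2).toLin _ + (-1 : k) ^ (1 + 1) •
    (thetaDual h2 b).1 ((calculusSphere q).dForms 1 x) : podles q) : OqSL2 q) = _
  rw [← theta_sphereConnection_psi h2, thetaDual_theta]
  rw [Subalgebra.coe_add, Subalgebra.coe_smul, Subalgebra.coe_mul, coe_sphereConnection,
    coe_sphereConnection, h.1, h.2, dualPlus_psi, dualMinus_psi]
  simp only [map_smul, map_neg, partialD_mul, sigma_of_mem _ hp, sigma_of_mem _ hm, OneForm.wt,
    mul_smul_comm, smul_mul_assoc, mul_add, Units.val_zpow_eq_zpow_val]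
  match_scalars <;> norm_num

/-- Every functional on two-forms is `φ b`, so its curvature is carried by `Θ` to `d(db) = 0`. -/
theorem sphereConnection_isFlat : (sphereConnection h2).IsFlat := by
  intro f
  obtain ⟨b, rfl⟩ := (thetaDual h2).surjective f
  rw [higher_thetaDual]
  apply (theta h2).injective
  rw [theta_sphereConnection_psi, map_zero]
  exact Subtype.ext (d_d q _)

end Connection

/-! ### The section `Π` and the descent of the connection from `A`. -/

section Descent

variable {q : kˣ} (h2 : (q : k) ^ 2 ≠ 1)

/-- The tensor `x ⊗ a`. -/
def tensorMk (q : kˣ) (x : (calculusSphere q).forms 1) : OqSL2 q →ₗ[k] SphereTensor q :=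
  ((calculusSphere q).balancing (podles q).val).mkQ ∘ₗ
    TensorProduct.mk k _ _ ((calculusSphere q).toOneForms x)

theorem tensorMk_bimul (x : (calculusSphere q).forms 1) (b : podles q) (a : OqSL2 q) :
    tensorMk q ((calculusSphere q).bimul 1 b x) a = tensorMk q x (b * a) := by
  refine (Submodule.Quotient.eq _).2 (Submodule.subset_span ⟨x, b, a, rfl⟩)

theorem sphereJ_tensorMk (x : (calculusSphere q).forms 1) (a : OqSL2 q) :
    sphereJ q (tensorMk q x a) = x * incl q a := rfl

theorem sphereHat_tensorMk (f : (calculusSphere q).RHom 1) (x : (calculusSphere q).forms 1)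
    (a : OqSL2 q) : sphereHat q f (tensorMk q x a) = f.1 x * a := rfl

/-- The map `ω_- a + ω_0 b + ω_+ c ↦ ∑ u_i ⊗ a_i a + ∑ q_i w_i ⊗ b_i c`. -/
def horizontalMap : Omega q →ₗ[k] SphereTensor q :=
  (∑ i, tensorMk q (uForm h2 i) ∘ₗ LinearMap.mulLeft k (aa q i) ∘ₗ rcoef q minus) +
    ∑ i, qq q i • tensorMk q (wForm h2 i) ∘ₗ LinearMap.mulLeft k (bb q i) ∘ₗ rcoef q plus

theorem horizontalMap_apply (x : Omega q) :
    horizontalMap h2 x = ∑ i, tensorMk q (uForm h2 i) (aa q i * rcoef q minus x) +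
      ∑ i, qq q i • tensorMk q (wForm h2 i) (bb q i * rcoef q plus x) := by
  simp [horizontalMap]

theorem sphereJ_horizontalMap (x : Omega q) :
    sphereJ q (horizontalMap h2 x) = form q minus * incl q (rcoef q minus x) +
      form q plus * incl q (rcoef q plus x) := by
  rw [horizontalMap_apply]
  simp only [map_add, map_sum, map_smul, sphereJ_tensorMk, uForm, wForm, plusForm, minusForm,
    LinearMap.coe_mk, AddHom.coe_mk, mul_assoc, ← map_mul, ← mul_smul_comm, ← Finset.mul_sum]
  simp only [← map_smul, ← map_sum, sum_aa_mul_bb_mul]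
  simp only [← mul_assoc, ← Finset.sum_mul, sum_bb_mul_aa, one_mul]

theorem sphereHat_horizontalMap (f : (calculusSphere q).RHom 1) (x : Omega q) :
    sphereHat q f (horizontalMap h2 x) =
      dualPlus h2 f * rcoef q plus x + dualMinus h2 f * rcoef q minus x := by
  rw [horizontalMap_apply, coe_dualPlus, coe_dualMinus, add_comm]
  simp only [map_add, map_sum, map_smul, sphereHat_tensorMk, Finset.sum_mul, smul_mul_assoc,
    mul_assoc]

theorem tensorMk_add (x y : (calculusSphere q).forms 1) (a : OqSL2 q) :
    tensorMk q (x + y) a = tensorMk q x a + tensorMk q y a := by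
  simp [tensorMk, TensorProduct.add_tmul]

theorem tensorMk_smul (c : k) (x : (calculusSphere q).forms 1) (a : OqSL2 q) :
    tensorMk q (c • x) a = c • tensorMk q x a := by
  rw [tensorMk, tensorMk, LinearMap.comp_apply, TensorProduct.mk_apply, map_smul,
    ← TensorProduct.smul_tmul', map_smul]
  rfl

theorem tensorMk_sum {ι : Type*} (s : Finset ι) (x : ι → (calculusSphere q).forms 1) (a : OqSL2 q) :
    tensorMk q (∑ i ∈ s, x i) a = ∑ i ∈ s, tensorMk q (x i) a := by
  simp [tensorMk, TensorProduct.sum_tmul]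

/-- This contains the injectivity of `j`. Once `x` is expanded in `w_i` and `u_i`, its coefficients
lie in `B` and can cross the balanced tensor sign. -/
theorem horizontalMap_sphereJ (t : SphereTensor q) : horizontalMap h2 (sphereJ q t) = t := by
  have h : horizontalMap h2 ∘ₗ sphereJ q = LinearMap.id := by
    refine Submodule.linearMap_qext _ (TensorProduct.ext' fun x a => ?_)
    obtain ⟨x, rfl⟩ := (calculusSphere q).toOneForms.surjective x
    change horizontalMap h2 (sphereJ q (tensorMk q x a)) = tensorMk q x a
    have hx : tensorMk q x a = tensorMk q (plusForm h2 (plusPart h2 x) +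
      minusForm h2 (minusPart h2 x)) a := by rw [plusForm_add_minusForm]
    rw [sphereJ_tensorMk, horizontalMap_apply, rcoef_mul_incl, rcoef_mul_incl, hx, tensorMk_add,
      plusForm_eq_sum, minusForm_eq_sum, tensorMk_sum, tensorMk_sum, add_comm]
    simp only [tensorMk_smul, tensorMk_bimul, bbMul, aaMul, coe_plusPart, coe_minusPart, mul_assoc]
  exact DFunLike.congr_fun h t

/-- The horizontal section. -/
def horizontalSection : (calculus3D q).forms 1 →ₗ[k] SphereTensor q :=
  horizontalMap h2 ∘ₗ Submodule.subtype _

theorem isHorizontalSection : IsHorizontalSection q (horizontalSection h2) := by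
  constructor
  · intro x t h
    change horizontalMap h2 (x : Omega q) = t
    rw [h, horizontalMap_sphereJ]
  · intro x a b c h
    change sphereJ q (horizontalMap h2 (x : Omega q)) = _
    rw [sphereJ_horizontalMap, h]
    simp only [map_add, rcoef_form_mul]
    simp

/-- The extended functional takes the values `0`, `s`, `t` at `ω_0`, `ω_+`, `ω_-`, where `(s, t)`
are the coordinates of `f`; the formula for `∇` then loses its `∂_0` term. -/
theorem isDescended : IsDescended q (horizontalSection h2) (sphereConnection h2) := by
  intro f
  have hF : ∀ x, (sphereHat q f ∘ₗ horizontalSection h2) x =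
      dualPlus h2 f * rcoef q plus (x : Omega q) + dualMinus h2 f * rcoef q minus (x : Omega q) :=
    fun x => sphereHat_horizontalMap h2 f x
  refine ⟨⟨sphereHat q f ∘ₗ horizontalSection h2, fun x a => ?_⟩, rfl, ?_⟩
  · have e : ((calculus3D q).bimul 1 a x : Omega q) = x * incl q a := by
      change incl q 1 * (x : Omega q) * incl q a = _
      rw [map_one, one_mul]
    rw [hF, hF, e, rcoef_mul_incl, rcoef_mul_incl, add_mul, mul_assoc, mul_assoc]
  · have e : ∀ i j, rcoef q i (oneForm q j : Omega q) = open Classical in if j = i then 1 else 0 :=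
      fun i j => by
        rw [← rcoef_form_mul, map_one, mul_one]
        rfl
    rw [coe_sphereConnection]
    simp only [nabla3D, hF, e]
    simp

end Descent

/-! ### The isomorphism with the de Rham complex. -/

section DeRham

variable {q : kˣ} (h2 : (q : k) ^ 2 ≠ 1)

theorem DGAlg.HomConnection.integralIsoDeRham_two {A : Type v} {W : Type w} [Ring A] [Algebra k A]
    [Ring W] [Algebra k W] {E : DGAlg k A W} (N : E.HomConnection) (h : ∀ n, 2 < n → E.forms n = ⊥)
    (e₀ : E.forms 0 ≃ₗ[k] E.RHom 2) (e₁ : E.forms 1 ≃ₗ[k] E.RHom 1) (e₂ : E.forms 2 ≃ₗ[k] E.RHom 0)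
    (h₀ : ∀ x, N.higher 1 (e₀ x) = e₁ (E.dForms 0 x))
    (h₁ : ∀ x, N.higher 0 (e₁ x) = e₂ (E.dForms 1 x)) : N.IntegralIsoDeRham 2 := by
  refine ⟨h, fun n m hnm => match n, m, hnm with
    | 0, 2, _ => e₀
    | 1, 1, _ => e₁
    | 2, 0, _ => e₂
    | 0, 0, h => absurd h (by omega)
    | 0, 1, h => absurd h (by omega)
    | 0, m + 3, h => absurd h (by omega)
    | 1, 0, h => absurd h (by omega)
    | 1, m + 2, h => absurd h (by omega)
    | 2, m + 1, h => absurd h (by omega)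
    | n + 3, m, h => absurd h (by omega), ?_⟩
  intro n m hnm hnm' x
  obtain ⟨rfl, rfl⟩ | ⟨rfl, rfl⟩ : n = 0 ∧ m = 1 ∨ n = 1 ∧ m = 0 := by omega
  · exact h₀ x
  · exact h₁ x

/-- An algebra as its own module of zero-forms. -/
def DGAlg.formsZeroEquiv {A : Type v} {W : Type w} [Ring A] [Algebra k A] [Ring W] [Algebra k W]
    (E : DGAlg k A W) : A ≃ₗ[k] E.forms 0 :=
  LinearEquiv.ofBijective (E.incl.toLinearMap.codRestrict _ E.incl_mem) ⟨fun a b h =>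
    E.incl_injective (congrArg Subtype.val h), fun ⟨x, hx⟩ => by
      rw [E.forms_zero] at hx
      obtain ⟨a, rfl⟩ := hx
      exact ⟨a, rfl⟩⟩

theorem DGAlg.coe_formsZeroEquiv {A : Type v} {W : Type w} [Ring A] [Algebra k A] [Ring W]
    [Algebra k W] (E : DGAlg k A W) (a : A) : (E.formsZeroEquiv a : W) = E.incl a := rfl

theorem DGAlg.bimul_formsZeroEquiv {A : Type v} {W : Type w} [Ring A] [Algebra k A] [Ring W]
    [Algebra k W] (E : DGAlg k A W) (a b c : A) :
    E.bimul a b (E.formsZeroEquiv c) = E.formsZeroEquiv (a * c * b) := by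
  ext
  simp [DGAlg.bimul, DGAlg.coe_formsZeroEquiv]

/-- An algebra as the dual of its zero-forms. -/
def DGAlg.dualZeroEquiv {A : Type v} {W : Type w} [Ring A] [Algebra k A] [Ring W] [Algebra k W]
    (E : DGAlg k A W) : A ≃ₗ[k] E.RHom 0 where
  toFun a := ⟨LinearMap.mulLeft k a ∘ₗ E.formsZeroEquiv.symm.toLinearMap, fun x b => by
    obtain ⟨c, rfl⟩ := E.formsZeroEquiv.surjective x
    rw [E.bimul_formsZeroEquiv]
    simp [mul_assoc]⟩
  map_add' a b := by ext; simp [add_mul]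
  map_smul' c a := by ext; simp
  invFun f := f.1 (E.formsZeroEquiv 1)
  left_inv a := by simp
  right_inv f := by
    ext x
    obtain ⟨c, rfl⟩ := E.formsZeroEquiv.surjective x
    change f.1 (E.formsZeroEquiv 1) * E.formsZeroEquiv.symm (E.formsZeroEquiv c) = _
    rw [← f.2, E.bimul_formsZeroEquiv]
    simp

/-- For `x = a` in degree zero the sign is `-1`, and the Leibniz rule cancels `f(da)`, leaving `∇(f)
a`. Thus the last map of the integral complex is `∇` itself. -/
theorem DGAlg.HomConnection.higher_zero {A : Type v} {W : Type w} [Ring A] [Algebra k A]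
    [Ring W] [Algebra k W] {E : DGAlg k A W} (N : E.HomConnection) (f : E.RHom 1) :
    N.higher 0 f = E.dualZeroEquiv (N.toLin f) := by
  ext x
  obtain ⟨a, rfl⟩ := E.formsZeroEquiv.surjective x
  have h1 : E.formAct (m := 0) (n := 1) f (E.formsZeroEquiv a) = E.dualBimul 1 a f := by
    ext z
    change f.1 _ = 1 * f.1 _
    rw [one_mul]
    congr 1
    ext
    simp [DGAlg.wedge, DGAlg.bimul, DGAlg.coe_formsZeroEquiv]
  have h2 : E.dForms 0 (E.formsZeroEquiv a) = E.dAlg a := rfl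
  change N.toLin _ + (-1 : k) ^ (0 + 1) • f.1 _ =
    N.toLin f * E.formsZeroEquiv.symm (E.formsZeroEquiv a)
  rw [h1, N.leibniz, h2]
  simp

theorem sphereConnection_integralIsoDeRham : (sphereConnection h2).IntegralIsoDeRham 2 := by
  refine DGAlg.HomConnection.integralIsoDeRham_two _ (fun n hn => formsB_eq_bot h2 hn)
    ((calculusSphere q).formsZeroEquiv.symm.trans (thetaDual h2)) (psi h2)
    ((theta h2).symm.trans (calculusSphere q).dualZeroEquiv) (fun x => ?_) (fun x => ?_)
  · obtain ⟨b, rfl⟩ := (calculusSphere q).formsZeroEquiv.surjective x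
    rw [LinearEquiv.trans_apply, LinearEquiv.symm_apply_apply, higher_thetaDual]
    rfl
  · rw [DGAlg.HomConnection.higher_zero, LinearEquiv.trans_apply, ← theta_sphereConnection_psi h2,
      LinearEquiv.symm_apply_apply]

end DeRham

end QSphere

end

open QSphere QSphere.OneForm
theorem mainTheorem7 {k : Type*} [Field k] [CharZero k] (q : kˣ)
    (hq : ∀ n : ℕ, 0 < n → q ^ n ≠ 1) :
    ∃ (Pi : (calculus3D q).forms 1 →ₗ[k] SphereTensor q)
      (N : (calculusSphere q).HomConnection)
      (w v : Fin 3 → (calculusSphere q).forms 1)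
      (ws vs : Fin 3 → (calculusSphere q).RHom 1)
      (φ : (calculusSphere q).RHom 2)
      (Ψ : (calculusSphere q).forms 1 ≃ₗ[k] (calculusSphere q).RHom 1)
      (Θs : podles q ≃ₗ[k] (calculusSphere q).RHom 2)
      (Θ : podles q ≃ₗ[k] (calculusSphere q).forms 2),
      IsHorizontalSection q Pi ∧
      IsDescended q Pi N ∧
      (∀ i, (w i : Omega q) = Omega.form q plus * Omega.incl q (aa q i)) ∧
      (∀ i, (v i : Omega q) = Omega.form q minus * Omega.incl q (bb q i)) ∧
      IsCompl (bimodSpan q w) (bimodSpan q v) ∧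
      (∀ i j, ((ws i).1 (w j) : OqSL2 q) = qq q i • (bb q i * aa q j) ∧ (ws i).1 (v j) = 0 ∧
        ((vs i).1 (v j) : OqSL2 q) = aa q i * bb q j ∧ (vs i).1 (w j) = 0) ∧
      (∀ x, Ψ x = ∑ i, (calculusSphere q).dualBimul 1 ((ws i).1 x) (vs i)
        - ((q : k) ^ 2) • ∑ i, (qq q i)⁻¹ • (calculusSphere q).dualBimul 1 ((vs i).1 x) (ws i)) ∧
      (∀ b, (Θ b : Omega q) = Omega.form q minus * Omega.form q plus * (calculusSphere q).incl b) ∧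
      (∀ b, φ.1 (Θ b) = b) ∧
      (∀ b, Θs b = (calculusSphere q).dualBimul 1 b φ) ∧
      (∀ a b x, Ψ ((calculusSphere q).bimul a b x) = (calculusSphere q).dualBimul a b (Ψ x)) ∧
      (∀ a b c, Θs (a * c * b) = (calculusSphere q).dualBimul a b (Θs c)) ∧
      (∀ a b c, Θ (a * c * b) = (calculusSphere q).bimul a b (Θ c)) ∧
      (∀ b, N.higher 1 (Θs b) = Ψ ((calculusSphere q).dAlg b)) ∧
      (∀ x, Θ (N.toLin (Ψ x)) = (calculusSphere q).dForms 1 x) ∧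
      N.IsFlat ∧
      N.IntegralIsoDeRham 2 := by
  -- The instance `n = 2` of the assumption that `q` is not a root of unity.
  have h2 : (q : k) ^ 2 ≠ 1 := fun h => hq 2 two_pos (Units.ext (by simpa using h))
  refine ⟨horizontalSection h2, sphereConnection h2, wForm h2, uForm h2, wDual h2, uDual h2,
    phi h2, psi h2, thetaDual h2, theta h2, isHorizontalSection h2, isDescended h2, fun _ => rfl,
    fun _ => rfl, isCompl_bimodSpan h2, fun i j => ⟨?_, Subtype.ext ?_, ?_, Subtype.ext ?_⟩,
    psi_eq_sum h2, fun _ => rfl, phi_theta h2, fun _ => rfl, psi_bimul h2, thetaDual_bimul h2,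
    theta_bimul h2, higher_thetaDual h2, theta_sphereConnection_psi h2, sphereConnection_isFlat h2,
    sphereConnection_integralIsoDeRham h2⟩
  · rw [wDual_apply, wForm, rcoef_plus_plusForm]
  · rw [wDual_apply, uForm, rcoef_plus_minusForm, mul_zero, smul_zero]
    rfl
  · rw [uDual_apply, uForm, rcoef_minus_minusForm]
  · rw [uDual_apply, wForm, rcoef_minus_plusForm, mul_zero]
    rfl
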